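/- Let $N \ge 2$ be an integer, $n := 2^N$ and $\lg n := \log_2 n = N$. Positions are $\{0, \dots, n-1\}$, and addition of positions is modulo $n$. A matching is a set of pairwise disjoint pairs of positions. For integers $d, k \ge 1$ with $k \le N - 1$, let $$E_{d,k} := \bigl\{ \{i, i+d\} : 0 \le i < n/2^{k+1} \bigr\}, \qquad M_0(d,k) := \bigcup_{\ell=0}^{2^{k-1}-1} \bigl( \ell n/2^{k-1} + E_{d,k} \bigr), \qquad M_r(d,k) := r n/2^{k+1} + M_0(d,k) \quad (r \in \{1,2,3\}),$$ where $a + S$ denotes the set of all pairs $\{a+i, a+j\}$ with $\{i,j\} \in S$. Define a random set of pairs $M \sim \tilde q$ as follows. 1. Sample $K$ uniformly from $\{1, \dots, \lg n\}$ and, conditionally on $K$, sample $D$ uniformly from the integers in $(n/2^{K+1}, n/2^K]$. 2. Independently, sample $R$ uniformly from $\{0,1,2,3\}$. 3. Set $M := M_R(D, K)$ if $K \le N-1$. If $K = N$ (so that $D = 1$), set $M := M_R(1, N-1) = \{ \{4\ell + R, 4\ell + R + 1\} : 0 \le \ell < n/4 \}$. Then $M$ is always a matching, and $|M| = n/4$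 deterministically. In each round, the parallel sorter associated with $\tilde q$ draws a fresh independent matching $M \sim \tilde q$ and, for every pair $\{i,j\} \in M$ with $i < j$, swaps the entries in positions $i$ and $j$ if the entry in position $i$ is the larger one. Let $\tau_x$ be the number of rounds until the list $x$ of length $n$, with entries in an arbitrary linearly ordered set, is in nondecreasing order for the first time. The worst-case value of $\tau_x$ is of order $(\log n)^2$, both in expectation and with polynomially small failure probability. That is, with constants that do not depend on $N$ or on the list: - (upper bound, expectation) there is $C > 0$ such that $\mathbb{E}[\tau_x] \le C (\log n)^2$ for all $N \ge 2$ and all lists $x$ of length $n$; - (upper bound, probability) for every $\gamma > 0$ there is $C > 0$ such that $\mathbb{P}(\tau_x > C (\log n)^2) \le n^{-\gamma}$ for all $N \ge 2$ and all lists $x$ of length $n$; - (lower bound) there are $c, \gamma > 0$ such that, for every $N \ge 2$, some permutation $x$ of $\{0, \dots, n-1\}$ satisfies both $\mathbb{E}[\tau_x] \ge c (\log n)^2$ and $\mathbb{P}(\tau_x < c (\log n)^2) \le n^{-\gamma}$. -/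

import Mathlib

open MeasureTheory
open scoped ENNReal

namespace ParSort

/-- A matching of the positions `0, …, n - 1`: a finite set of pairs of distinct positions, such
that every position lies in at most one of the pairs. -/
def IsMatching {n : ℕ} (M : Finset (Sym2 (Fin n))) : Prop :=
  (∀ e ∈ M, ¬ e.IsDiag) ∧ ∀ i : Fin n, ∀ e ∈ M, ∀ f ∈ M, i ∈ e → i ∈ f → e = f

open Classical in
/-- Sort a list along a matching: for every pair `{i, j}` of `M` with `i < j`, the smaller of the
two entries is put in position `i` and the larger one in position `j`; the unmatched positions keep
their entries. (For a matching, the partner `j` of a matched position `i` is unique.) -/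
noncomputable def sortAlong {n : ℕ} {α : Type*} [LinearOrder α]
    (M : Finset (Sym2 (Fin n))) (x : Fin n → α) : Fin n → α := fun i =>
  if h : ∃ j, s(i, j) ∈ M then
    if i < h.choose then min (x i) (x h.choose) else max (x i) (x h.choose)
  else x i

/-- The state of the list `x` after the first `t` rounds, when round `s + 1` uses `M s`. -/
noncomputable def state {n : ℕ} {α : Type*} [LinearOrder α]
    (M : ℕ → Finset (Sym2 (Fin n))) (x : Fin n → α) : ℕ → Fin n → α
  | 0 => x
  | t + 1 => sortAlong (M t) (state M x t)

/-- The number of rounds after which the list is sorted for the first time (`⊤` if this never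
happens). -/
noncomputable def sortTime {n : ℕ} {α : Type*} [LinearOrder α]
    (x : Fin n → α) (M : ℕ → Finset (Sym2 (Fin n))) : ℕ∞ :=
  ⨅ (t : ℕ) (_ : Monotone (state M x t)), (t : ℕ∞)

instance instMeasurableSpaceEdgeSet (n : ℕ) : MeasurableSpace (Finset (Sym2 (Fin n))) := ⊤

/-- The law of a sequence of independent samples from `q`, one for each round. -/
noncomputable def roundsLaw {n : ℕ} (q : PMF (Finset (Sym2 (Fin n)))) :
    Measure (ℕ → Finset (Sym2 (Fin n))) :=
  Measure.infinitePi fun _ : ℕ => q.toMeasure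

/-- The set of pairs `a + M`, addition being modulo `n`. -/
def shift {n : ℕ} [NeZero n] (a : ℕ) (M : Finset (Sym2 (Fin n))) : Finset (Sym2 (Fin n)) :=
  M.image (Sym2.map fun i => i + Fin.ofNat n a)

/-- The fundamental block `E_{d,k}`: the pairs `{i, i + d}` modulo `n`, for `0 ≤ i < n / 2^(k+1)`. -/
def block (n : ℕ) [NeZero n] (d k : ℕ) : Finset (Sym2 (Fin n)) :=
  (Finset.range (n / 2 ^ (k + 1))).image fun i => s(Fin.ofNat n i, Fin.ofNat n (i + d))

/-- `M_0`: the union of the blocks `ℓ n / 2^(k-1) + E_{d,k}`, for `0 ≤ ℓ < 2^(k-1)`. -/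
def baseMatching (n : ℕ) [NeZero n] (d k : ℕ) : Finset (Sym2 (Fin n)) :=
  (Finset.range (2 ^ (k - 1))).biUnion fun l => shift (l * (n / 2 ^ (k - 1))) (block n d k)

/-- `M_r = r n / 2^(k+1) + M_0`. -/
def rotatedMatching (n : ℕ) [NeZero n] (d k r : ℕ) : Finset (Sym2 (Fin n)) :=
  shift (r * (n / 2 ^ (k + 1))) (baseMatching n d k)

/-- For `k ≤ N`, the set of the integers `d` with `n / 2^(k+1) < d ≤ n / 2^k`, where `n = 2^N`, is
not empty. -/
theorem lengths_nonempty {N k : ℕ} (hk : k ≤ N) :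
    (Finset.Ioc (2 ^ N / 2 ^ (k + 1)) (2 ^ N / 2 ^ k) : Finset ℕ).Nonempty := by
  rw [Finset.nonempty_Ioc, pow_succ, ← Nat.div_div_eq_div_mul]
  exact Nat.div_lt_self (Nat.div_pos (Nat.pow_le_pow_right (by norm_num) hk) (by positivity))
    (by norm_num)

/-- The law of the random matching for `n = 2^N`. Here `j` is uniform in `{0, …, N - 1}`, so that
`K = j + 1` is uniform in `{1, …, N}`; given `K`, the length `D` is uniform among the integers in
`(n / 2^(K+1), n / 2^K]`; and `R` is uniform in `{0, 1, 2, 3}`. The matching is `M_R`, built with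
`min K (N - 1)` for the number and the size of its blocks: this is `K`, except at the
last scale `K = N`, where `D = 1` and `n / 2^(K+1)` is not an integer. -/
noncomputable def matchingLaw (N : ℕ) [NeZero N] : PMF (Finset (Sym2 (Fin (2 ^ N)))) :=
  (PMF.uniformOfFintype (Fin N)).bind fun j =>
    (PMF.uniformOfFinset
      (Finset.Ioc (2 ^ N / 2 ^ ((j : ℕ) + 1 + 1)) (2 ^ N / 2 ^ ((j : ℕ) + 1)))
      (lengths_nonempty j.2)).bind fun d =>
        (PMF.uniformOfFintype (Fin 4)).map fun r =>
          rotatedMatching (2 ^ N) d (min ((j : ℕ) + 1) (N - 1)) r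

end ParSort

namespace ParSort


/-! The key property of the law is that positions `i < j` are compared with probability of order `1
/ (N (j - i))`. The lower estimate `1 / (4 N (j - i))` holds for all pairs (`le_pairProb`), the
upper estimate `1 / (2 N (j - i))` for pairs in the left half (`pairProb_le`). Indeed a scale has
probability `1 / N`, the scale of a length `d` contains between `d / 2` and `d` lengths, and the
four values of `R` share out the starting points `a` of the pairs `{a, a + d}`.

Upper bound. Let the disorder be the sum of `(z i - z j)⁺` over `i < j`. Up to terms invariant under
permutations it equals `-∑ i * z i`, so sorting an inverted pair `i < j` lowers it by exactly `(j -
i) (z i - z j)`. The factor `j - i` cancels the one in the probability, and a round multiplies the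
expected disorder by at most `1 - 1 / (4 N)` (`sum_mul_disorder_le`). With entries replaced by their
ranks, the disorder starts at no more than `n ^ 3` and is at least `1` while the list is unsorted.
Markov's inequality gives `P(not sorted after t rounds) ≤ n ^ 3 * exp (-t / (4 N))`, hence both
upper bounds.

Lower bound. Follow the smallest entry, with weight `1 / √(i + 1)` when it is at `i` in the left
half. Since the sum over `i < j` of `(w i - w j) / (j - i)` is at most `2 * w j`
(`sum_sqrt_jump_le`), a round multiplies the expected weight by at most `1 + 1 / N`
(`sum_mul_smallWeight_le`). The weight is `(n / 2) ^ (-1 / 2)` at the last position of the left half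
and `1` once the list is sorted, so this growth takes order `N ^ 2` rounds. -/

/-! ### Sorting along one matching -/

theorem IsMatching.eq_of_mem {n : ℕ} {M : Finset (Sym2 (Fin n))} (hM : IsMatching M) {i j k : Fin n}
    (hj : s(i, j) ∈ M) (hk : s(i, k) ∈ M) : j = k :=
  Sym2.congr_right.1 (hM.2 i _ hj _ hk (Sym2.mem_mk_left _ _) (Sym2.mem_mk_left _ _))

theorem IsMatching.ne {n : ℕ} {M : Finset (Sym2 (Fin n))} (hM : IsMatching M) {i j : Fin n}
    (hj : s(i, j) ∈ M) : i ≠ j := fun h => hM.1 _ hj (Sym2.mk_isDiag_iff.2 h)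

theorem sortAlong_of_mem {n : ℕ} {α : Type*} [LinearOrder α] {M : Finset (Sym2 (Fin n))}
    (hM : IsMatching M) (y : Fin n → α) {i j : Fin n} (h : s(i, j) ∈ M) :
    sortAlong M y i = if i < j then min (y i) (y j) else max (y i) (y j) := by
  have hex : ∃ j, s(i, j) ∈ M := ⟨j, h⟩
  have hc : hex.choose = j := hM.eq_of_mem hex.choose_spec h
  simp only [sortAlong, dif_pos hex, hc]

theorem sortAlong_of_forall_notMem {n : ℕ} {α : Type*} [LinearOrder α] {M : Finset (Sym2 (Fin n))}
    (y : Fin n → α) {i : Fin n} (h : ∀ j, s(i, j) ∉ M) : sortAlong M y i = y i := by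
  have hex : ¬ ∃ j, s(i, j) ∈ M := fun ⟨j, hj⟩ => h j hj
  simp only [sortAlong, dif_neg hex]

theorem sortAlong_of_monotone {n : ℕ} {α : Type*} [LinearOrder α] (M : Finset (Sym2 (Fin n)))
    {y : Fin n → α} (hy : Monotone y) : sortAlong M y = y := by
  funext i
  unfold sortAlong
  split_ifs with h h'
  · exact min_eq_left (hy h'.le)
  · exact max_eq_left (hy (not_lt.1 h'))
  · rfl

/-- Sorting along a matching permutes the entries. -/
theorem exists_perm_sortAlong {n : ℕ} {α : Type*} [LinearOrder α] {M : Finset (Sym2 (Fin n))}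
    (hM : IsMatching M) (y : Fin n → α) : ∃ σ : Equiv.Perm (Fin n), sortAlong M y = y ∘ σ := by
  classical
  -- Matched pairs that are strictly inverted: exactly these are exchanged, and the exchange is an
  -- involution.
  let Q : Fin n → Fin n → Prop := fun i j =>
    s(i, j) ∈ M ∧ ((i < j ∧ y j < y i) ∨ (j < i ∧ y i < y j))
  have hQs : ∀ {i j}, Q i j → Q j i := fun {i j} h => ⟨Sym2.eq_swap ▸ h.1, h.2.symm⟩
  let f : Fin n → Fin n := fun i => if h : ∃ j, Q i j then h.choose else i
  have hf : ∀ {i j}, Q i j → f i = j := fun {i j} h => by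
    have hex : ∃ j, Q i j := ⟨j, h⟩
    simp only [f, dif_pos hex]
    exact hM.eq_of_mem hex.choose_spec.1 h.1
  have hf' : ∀ {i}, (∀ j, ¬ Q i j) → f i = i := fun {i} h => by
    have hex : ¬ ∃ j, Q i j := fun ⟨j, hj⟩ => h j hj
    simp only [f, dif_neg hex]
  have hinv : Function.Involutive f := fun i => by
    by_cases h : ∃ j, Q i j
    · obtain ⟨j, hj⟩ := h
      rw [hf hj, hf (hQs hj)]
    · push Not at h
      rw [hf' h, hf' h]
  refine ⟨hinv.toPerm f, funext fun i => ?_⟩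
  change sortAlong M y i = y (f i)
  by_cases h : ∃ j, s(i, j) ∈ M
  · obtain ⟨j, hj⟩ := h
    rw [sortAlong_of_mem hM y hj]
    by_cases hq : Q i j
    · rw [hf hq]
      rcases hq.2 with h | h
      · rw [if_pos h.1, min_eq_right h.2.le]
      · rw [if_neg h.1.le.not_gt, max_eq_right h.2.le]
    · rw [hf' fun k hk => hq (hM.eq_of_mem hk.1 hj ▸ hk)]
      have hne := hM.ne hj
      rcases lt_or_gt_of_ne hne with h | h
      · rw [if_pos h, min_eq_left]
        by_contra! hc
        exact hq ⟨hj, Or.inl ⟨h, hc⟩⟩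
      · rw [if_neg h.le.not_gt, max_eq_left]
        by_contra! hc
        exact hq ⟨hj, Or.inr ⟨h, hc⟩⟩
  · push Not at h
    rw [sortAlong_of_forall_notMem y h, hf' fun j hj => h j hj.1]

open Classical in
/-- Sorting along a matching changes a weighted sum by a sum over the inverted pairs. -/
theorem sum_mul_sortAlong {n : ℕ} {α : Type*} [LinearOrder α] {M : Finset (Sym2 (Fin n))}
    (hM : IsMatching M) (y : Fin n → α) {h : α → ℝ} (hh : Monotone h) (g : Fin n → ℝ) :
    ∑ i, g i * h (sortAlong M y i) = ∑ i, g i * h (y i) +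
      ∑ i, ∑ j, if s(i, j) ∈ M then
        (if i < j then (g j - g i) * max (h (y i) - h (y j)) 0 else 0) else 0 := by
  -- The lower position of an inverted pair loses the positive part of the difference and the upper
  -- one gains it; exchanging `i` and `j` in the gain terms then collects both under `i < j`.
  have key : ∀ i, h (sortAlong M y i) - h (y i) = ∑ j, if s(i, j) ∈ M then
      ((if j < i then max (h (y j) - h (y i)) 0 else 0) -
        (if i < j then max (h (y i) - h (y j)) 0 else 0)) else 0 := fun i => by
    by_cases hi : ∃ j, s(i, j) ∈ M
    · obtain ⟨j, hj⟩ := hi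
      rw [Finset.sum_eq_single j (fun k _ hk => if_neg fun hk' => hk (hM.eq_of_mem hk' hj))
        (by simp), if_pos hj, sortAlong_of_mem hM y hj]
      have hne := hM.ne hj
      rcases lt_or_gt_of_ne hne with h' | h'
      · rw [if_pos h', if_pos h', if_neg h'.le.not_gt, hh.map_min]
        rcases le_total (h (y i)) (h (y j)) with h'' | h''
        · rw [min_eq_left h'', max_eq_right (by linarith)]; ring
        · rw [min_eq_right h'', max_eq_left (by linarith)]; ring
      · rw [if_neg h'.le.not_gt, if_pos h', if_neg h'.le.not_gt, hh.map_max]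
        rcases le_total (h (y i)) (h (y j)) with h'' | h''
        · rw [max_eq_right h'', max_eq_left (by linarith)]; ring
        · rw [max_eq_left h'', max_eq_right (by linarith)]; ring
    · push Not at hi
      simp [hi, sortAlong_of_forall_notMem y hi]
  rw [← sub_eq_iff_eq_add', ← Finset.sum_sub_distrib]
  simp_rw [← mul_sub, key, Finset.mul_sum]
  have hsplit : ∀ i j : Fin n, (g i * if s(i, j) ∈ M then
      ((if j < i then max (h (y j) - h (y i)) 0 else 0) -
        (if i < j then max (h (y i) - h (y j)) 0 else 0)) else 0) =
      (if s(i, j) ∈ M then (if j < i then g i * max (h (y j) - h (y i)) 0 else 0) else 0) -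
      (if s(i, j) ∈ M then (if i < j then g i * max (h (y i) - h (y j)) 0 else 0) else 0) :=
    fun i j => by split_ifs <;> ring
  simp_rw [hsplit, Finset.sum_sub_distrib]
  rw [Finset.sum_comm, ← Finset.sum_sub_distrib]
  refine Finset.sum_congr rfl fun i _ => ?_
  rw [← Finset.sum_sub_distrib]
  refine Finset.sum_congr rfl fun j _ => ?_
  rw [Sym2.eq_swap]
  split_ifs <;> ring

/-! ### The disorder of a list -/

/-- The total size of the inversions of a list of real numbers. -/
noncomputable def disorder {n : ℕ} (z : Fin n → ℝ) : ℝ :=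
  ∑ i, ∑ j, if i < j then max (z i - z j) 0 else 0

/-- Write `max u 0 = (|u| + u) / 2`. The first two terms on the right are invariant under
permutations of `z`, so only the last one reacts to sorting. -/
theorem disorder_eq {n : ℕ} (z : Fin n → ℝ) :
    disorder z = (∑ i, ∑ j, |z i - z j|) / 4 + ((n : ℝ) - 1) / 2 * ∑ i, z i -
      ∑ i : Fin n, (i : ℝ) * z i := by
  have h1 : ∑ i, ∑ j, |z i - z j| = 2 * ∑ i, ∑ j, if i < j then |z i - z j| else 0 := by
    have hs : ∀ i j : Fin n, |z i - z j| =
        (if i < j then |z i - z j| else 0) + if j < i then |z j - z i| else 0 := fun i j => by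
      rcases lt_trichotomy i j with h | h | h
      · simp [h, h.le.not_gt]
      · simp [h]
      · simp [h, h.le.not_gt, abs_sub_comm]
    simp_rw [two_mul]
    conv_lhs => enter [2, i, 2, j]; rw [hs i j]
    simp_rw [Finset.sum_add_distrib]
    congr 1
    exact Finset.sum_comm
  have h2 : ∑ i, ∑ j, (if i < j then z i else 0) = ∑ i : Fin n, ((n : ℝ) - 1 - i) * z i := by
    refine Finset.sum_congr rfl fun i _ => ?_
    rw [← Finset.sum_filter, Finset.sum_const, nsmul_eq_mul]
    have : (Finset.univ.filter fun j => i < j) = Finset.Ioi i := by ext; simp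
    rw [this, Fin.card_Ioi, Nat.sub_sub, Nat.cast_sub (by omega)]
    push_cast; ring
  have h3 : ∑ i, ∑ j, (if i < j then z j else 0) = ∑ i : Fin n, (i : ℝ) * z i := by
    rw [Finset.sum_comm]
    refine Finset.sum_congr rfl fun i _ => ?_
    rw [← Finset.sum_filter, Finset.sum_const, nsmul_eq_mul]
    have : (Finset.univ.filter fun j => j < i) = Finset.Iio i := by ext; simp
    rw [this, Fin.card_Iio]
  have h4 : disorder z = ((∑ i, ∑ j, if i < j then |z i - z j| else 0) +
      (∑ i, ∑ j, if i < j then z i else 0) - ∑ i, ∑ j, if i < j then z j else 0) / 2 := by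
    simp_rw [disorder, ← Finset.sum_add_distrib, ← Finset.sum_sub_distrib, Finset.sum_div]
    refine Finset.sum_congr rfl fun i _ => Finset.sum_congr rfl fun j _ => ?_
    split_ifs
    · rcases le_total (z i - z j) 0 with h | h
      · rw [max_eq_right h, abs_of_nonpos h]; ring
      · rw [max_eq_left h, abs_of_nonneg h]; ring
    · simp
  rw [h4, h1, h2, h3]
  have h5 : ∑ i : Fin n, ((n : ℝ) - 1 - i) * z i =
      ((n : ℝ) - 1) * ∑ i, z i - ∑ i : Fin n, (i : ℝ) * z i := by
    simp_rw [sub_mul, Finset.sum_sub_distrib, Finset.mul_sum]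
  rw [h5]; ring

theorem disorder_nonneg {n : ℕ} (z : Fin n → ℝ) : 0 ≤ disorder z :=
  Finset.sum_nonneg fun _ _ => Finset.sum_nonneg fun _ _ => by split_ifs <;> simp

theorem disorder_comp_perm {n : ℕ} (z : Fin n → ℝ) (σ : Equiv.Perm (Fin n)) :
    disorder (z ∘ σ) = disorder z -
      (∑ i : Fin n, (i : ℝ) * z (σ i) - ∑ i : Fin n, (i : ℝ) * z i) := by
  have h1 : ∑ i, ∑ j, |z (σ i) - z (σ j)| = ∑ i, ∑ j, |z i - z j| := by
    rw [← Equiv.sum_comp σ fun i => ∑ j, |z i - z j|]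
    exact Finset.sum_congr rfl fun i _ => Equiv.sum_comp σ fun j => |z (σ i) - z j|
  simp only [disorder_eq, Function.comp_apply, h1, Equiv.sum_comp σ z]
  ring

open Classical in
theorem disorder_sortAlong {n : ℕ} {α : Type*} [LinearOrder α] {M : Finset (Sym2 (Fin n))}
    (hM : IsMatching M) (y : Fin n → α) {h : α → ℝ} (hh : Monotone h) :
    disorder (h ∘ sortAlong M y) = disorder (h ∘ y) -
      ∑ i : Fin n, ∑ j : Fin n, if s(i, j) ∈ M then
        (if i < j then ((j : ℝ) - i) * max (h (y i) - h (y j)) 0 else 0) else 0 := by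
  obtain ⟨σ, hσ⟩ := exists_perm_sortAlong hM y
  have := sum_mul_sortAlong hM y hh fun i => (i : ℝ)
  rw [hσ] at this ⊢
  rw [← Function.comp_assoc, disorder_comp_perm]
  simp only [Function.comp_apply] at this ⊢
  rw [this]; ring

/-! ### The random run of the sorter -/

theorem exists_perm_state {n : ℕ} {α : Type*} [LinearOrder α] {M : ℕ → Finset (Sym2 (Fin n))}
    (hM : ∀ t, IsMatching (M t)) (x : Fin n → α) (t : ℕ) :
    ∃ σ : Equiv.Perm (Fin n), state M x t = x ∘ σ := by
  induction t with
  | zero => exact ⟨1, rfl⟩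
  | succ t ih =>
    obtain ⟨σ, hσ⟩ := ih
    obtain ⟨ρ, hρ⟩ := exists_perm_sortAlong (hM t) (state M x t)
    exact ⟨ρ.trans σ, by rw [state, hρ, hσ]; rfl⟩

theorem state_congr {n : ℕ} {α : Type*} [LinearOrder α] {M M' : ℕ → Finset (Sym2 (Fin n))}
    (x : Fin n → α) {t : ℕ} (h : ∀ s < t, M s = M' s) : state M x t = state M' x t := by
  induction t with
  | zero => rfl
  | succ t ih => rw [state, state, h t t.lt_succ_self, ih fun s hs => h s (hs.trans t.lt_succ_self)]

theorem monotone_state_of_le {n : ℕ} {α : Type*} [LinearOrder α] {M : ℕ → Finset (Sym2 (Fin n))}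
    {x : Fin n → α} {s t : ℕ} (hst : s ≤ t) (h : Monotone (state M x s)) :
    Monotone (state M x t) := by
  induction t, hst using Nat.le_induction with
  | base => exact h
  | succ t _ ih => rwa [state, sortAlong_of_monotone _ ih]

theorem sortTime_le_iff {n : ℕ} {α : Type*} [LinearOrder α] {M : ℕ → Finset (Sym2 (Fin n))}
    {x : Fin n → α} {t : ℕ} : sortTime x M ≤ t ↔ Monotone (state M x t) := by
  refine ⟨fun h => ?_, fun h => iInf₂_le t h⟩
  have h' : sortTime x M < ((t + 1 : ℕ) : ℕ∞) := h.trans_lt (by exact_mod_cast t.lt_succ_self)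
  simp only [sortTime, iInf_lt_iff] at h'
  obtain ⟨s, hs, hst⟩ := h'
  exact monotone_state_of_le (Nat.lt_succ_iff.1 (by exact_mod_cast hst)) hs


instance {n : ℕ} (q : PMF (Finset (Sym2 (Fin n)))) : IsProbabilityMeasure (roundsLaw q) := by
  unfold roundsLaw; infer_instance

theorem roundsLaw_eval {n : ℕ} (q : PMF (Finset (Sym2 (Fin n)))) (t : ℕ)
    (S : Set (Finset (Sym2 (Fin n)))) : roundsLaw q {ω | ω t ∈ S} = q.toMeasure S := by
  have h := Measure.infinitePi_map_eval (fun _ : ℕ => q.toMeasure) t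
  rw [← h, Measure.map_apply (measurable_pi_apply t) (MeasurableSet.of_discrete (s := S))]
  rfl

theorem ae_mem_support {n : ℕ} (q : PMF (Finset (Sym2 (Fin n)))) :
    ∀ᵐ ω ∂roundsLaw q, ∀ t, ω t ∈ q.support := by
  refine ae_all_iff.2 fun t => ?_
  rw [ae_iff]
  have := roundsLaw_eval q t q.supportᶜ
  rw [(q.toMeasure_apply_eq_zero_iff trivial).2 disjoint_compl_right] at this
  exact this

/-- The state after `t` rounds as a function of the first `t` matchings. -/
noncomputable def stateOfPrefix {n : ℕ} {α : Type*} [LinearOrder α] (x : Fin n → α) (t : ℕ)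
    (u : Finset.range t → Finset (Sym2 (Fin n))) : Fin n → α :=
  state (fun s => if h : s ∈ Finset.range t then u ⟨s, h⟩ else ∅) x t

theorem stateOfPrefix_restrict {n : ℕ} {α : Type*} [LinearOrder α] (x : Fin n → α) (t : ℕ)
    (ω : ℕ → Finset (Sym2 (Fin n))) : stateOfPrefix x t (fun s => ω s) = state ω x t :=
  state_congr x fun s hs => by simp [hs]

theorem measurable_comp_state {n : ℕ} {α β : Type*} [LinearOrder α] [MeasurableSpace β]
    (x : Fin n → α) (t : ℕ) (F : (Fin n → α) → β) : Measurable fun ω => F (state ω x t) := by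
  simp_rw [← stateOfPrefix_restrict x t]
  exact (measurable_of_countable fun u : Finset.range t → Finset (Sym2 (Fin n)) =>
    F (stateOfPrefix x t u)).comp (measurable_pi_lambda _ fun s => measurable_pi_apply _)

theorem measurableSet_state {n : ℕ} {α : Type*} [LinearOrder α]
    (x : Fin n → α) (t : ℕ) (P : (Fin n → α) → Prop) : MeasurableSet {ω | P (state ω x t)} :=
  measurableSet_setOfPred.2 (measurable_comp_state x t P)

-- The Markov property: the matching of round `t + 1` is `ω t`, which is independent of the state
-- after `t` rounds because that state depends only on the coordinates below `t`.
open Classical in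
theorem lintegral_state_succ {n : ℕ} {α : Type*} [LinearOrder α] (q : PMF (Finset (Sym2 (Fin n))))
    (x : Fin n → α) (F : (Fin n → α) → ℝ≥0∞) (t : ℕ) :
    ∫⁻ ω, F (state ω x (t + 1)) ∂roundsLaw q =
      ∫⁻ ω, ∑ M, q M * F (sortAlong M (state ω x t)) ∂roundsLaw q := by
  have h1 : ∀ ω, F (state ω x (t + 1)) =
      ∑ M, (if ω t = M then 1 else 0) * F (sortAlong M (state ω x t)) := fun ω => by
    simp [state]
  have hm : ∀ M, Measurable fun ω : ℕ → Finset (Sym2 (Fin n)) =>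
      if ω t = M then (1 : ℝ≥0∞) else 0 := fun M =>
    (measurable_of_countable fun A : Finset (Sym2 (Fin n)) =>
      if A = M then (1 : ℝ≥0∞) else 0).comp (measurable_pi_apply t)
  have hs : ∀ M, Measurable fun ω => F (sortAlong M (state ω x t)) := fun M =>
    measurable_comp_state x t fun y => F (sortAlong M y)
  simp_rw [h1]
  rw [lintegral_finsetSum _ fun M _ => by exact (hm M).mul (hs M),
    lintegral_finsetSum _ fun M _ => (hs M).const_mul _]
  refine Finset.sum_congr rfl fun M _ => ?_
  rw [lintegral_const_mul _ (hs M)]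
  have hind : ProbabilityTheory.iIndepFun
      (fun (s : ℕ) (ω : ℕ → Finset (Sym2 (Fin n))) => ω s) (roundsLaw q) :=
    ProbabilityTheory.iIndepFun_infinitePi (P := fun _ : ℕ => q.toMeasure)
      (X := fun _ => id) fun _ => measurable_id
  have hpair := hind.indepFun_finset {t} (Finset.range t) (by simp)
    fun s => measurable_pi_apply s
  have hpair' := hpair.comp
    (measurable_of_countable fun u : ({t} : Finset ℕ) → Finset (Sym2 (Fin n)) =>
      if u ⟨t, by simp⟩ = M then (1 : ℝ≥0∞) else 0)
    (measurable_of_countable fun u : Finset.range t → Finset (Sym2 (Fin n)) =>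
      F (sortAlong M (stateOfPrefix x t u)))
  have hmul := ProbabilityTheory.lintegral_mul_eq_lintegral_mul_lintegral_of_indepFun
    (hm M) (hs M) (by
      convert hpair' using 1
      · rfl
      · funext ω
        exact congrArg (fun y => F (sortAlong M y)) (stateOfPrefix_restrict x t ω).symm)
  have hM : ∫⁻ ω : ℕ → Finset (Sym2 (Fin n)), (if ω t = M then (1 : ℝ≥0∞) else 0) ∂roundsLaw q =
      q M := by
    have : (fun ω : ℕ → Finset (Sym2 (Fin n)) => if ω t = M then (1 : ℝ≥0∞) else 0) =
        Set.indicator {ω | ω t ∈ ({M} : Set _)} 1 := by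
      funext ω; simp [Set.indicator_apply]
    have hms : MeasurableSet {ω : ℕ → Finset (Sym2 (Fin n)) | ω t ∈ ({M} : Set _)} :=
      measurable_pi_apply t (MeasurableSet.of_discrete (s := {M}))
    rw [this, lintegral_indicator_one hms, roundsLaw_eval,
      PMF.toMeasure_apply_singleton _ _ .of_discrete]
  rw [← hM]
  exact hmul

theorem lintegral_state_le {n : ℕ} {α : Type*} [LinearOrder α] (q : PMF (Finset (Sym2 (Fin n))))
    (x : Fin n → α) (F : (Fin n → α) → ℝ≥0∞) {c : ℝ≥0∞}
    (hF : ∀ y, ∑ M, q M * F (sortAlong M y) ≤ c * F y) (t : ℕ) :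
    ∫⁻ ω, F (state ω x t) ∂roundsLaw q ≤ c ^ t * F x := by
  induction t with
  | zero => simp [state]
  | succ t ih =>
    rw [lintegral_state_succ]
    calc _ ≤ ∫⁻ ω, c * F (state ω x t) ∂roundsLaw q := lintegral_mono fun ω => hF _
      _ = c * ∫⁻ ω, F (state ω x t) ∂roundsLaw q :=
        lintegral_const_mul _ (measurable_comp_state x t F)
      _ ≤ c * (c ^ t * F x) := by gcongr
      _ = c ^ (t + 1) * F x := by rw [pow_succ]; ring

/-- Markov's inequality for a potential with one-step factor `c`. Only rearrangements of `x` are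
reachable, so `1 ≤ F` is needed only on those. -/
theorem measure_state_le {n : ℕ} {α : Type*} [LinearOrder α] (q : PMF (Finset (Sym2 (Fin n))))
    (x : Fin n → α) (F : (Fin n → α) → ℝ≥0∞) {c : ℝ≥0∞}
    (hF : ∀ y, ∑ M, q M * F (sortAlong M y) ≤ c * F y) (P : (Fin n → α) → Prop)
    (hP : ∀ (σ : Equiv.Perm (Fin n)), P (x ∘ σ) → 1 ≤ F (x ∘ σ))
    (hq : ∀ M ∈ q.support, IsMatching M) (t : ℕ) :
    roundsLaw q {ω | P (state ω x t)} ≤ c ^ t * F x := by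
  refine le_trans ?_ (lintegral_state_le q x F hF t)
  rw [← lintegral_indicator_one (measurableSet_state x t P)]
  refine lintegral_mono_ae ?_
  filter_upwards [ae_mem_support q] with ω hω
  obtain ⟨σ, hσ⟩ := exists_perm_state (fun t => hq _ (hω t)) x t
  classical
  rw [Set.indicator_apply]
  split_ifs with h
  · change P (state ω x t) at h
    rw [hσ] at h ⊢
    exact hP σ h
  · exact zero_le

/-- The tail-sum bound for an expectation: a time at least `s` means that the list is unsorted after
each of `0, …, s - 1` rounds. The infinite value is reached through all finite `s`. -/
theorem lintegral_sortTime_le {n : ℕ} {α : Type*} [LinearOrder α]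
    (q : PMF (Finset (Sym2 (Fin n)))) (x : Fin n → α) :
    ∫⁻ ω, (sortTime x ω : ℝ≥0∞) ∂roundsLaw q ≤
      ∑' t : ℕ, roundsLaw q {ω | ¬ Monotone (state ω x t)} := by
  have h : ∀ ω, (sortTime x ω : ℝ≥0∞) ≤
      ∑' t : ℕ, {ω | ¬ Monotone (state ω x t)}.indicator 1 ω := fun ω => by
    have hlt : ∀ s : ℕ, (s : ℕ∞) ≤ sortTime x ω →
        (s : ℝ≥0∞) ≤ ∑' t : ℕ, {ω | ¬ Monotone (state ω x t)}.indicator 1 ω := fun s hs => by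
      calc (s : ℝ≥0∞) = ∑ t ∈ Finset.range s, 1 := by simp
        _ ≤ ∑ t ∈ Finset.range s, {ω | ¬ Monotone (state ω x t)}.indicator 1 ω := by
          refine Finset.sum_le_sum fun t ht => ?_
          rw [Set.indicator_of_mem]
          · rfl
          · intro hm
            have := hs.trans (sortTime_le_iff.2 hm)
            have : s ≤ t := by exact_mod_cast this
            simp at ht; omega
        _ ≤ _ := ENNReal.sum_le_tsum _
    rcases eq_or_ne (sortTime x ω) ⊤ with h | h
    · rw [h, ENat.toENNReal_top, top_le_iff]
      refine ENNReal.eq_top_of_forall_nnreal_le fun r => ?_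
      obtain ⟨s, hs⟩ := exists_nat_ge r
      exact le_trans (by exact_mod_cast hs) (hlt s (by rw [h]; exact le_top))
    · obtain ⟨s, hs⟩ := ENat.ne_top_iff_exists.1 h
      rw [← hs]
      exact hlt s hs.le
  refine (lintegral_mono h).trans ?_
  rw [lintegral_tsum fun t =>
    (measurable_one.indicator (measurableSet_state x t fun y => ¬ Monotone y)).aemeasurable]
  refine ENNReal.tsum_le_tsum fun t => ?_
  rw [lintegral_indicator_one (measurableSet_state x t fun y => ¬ Monotone y)]


/-! ### The shape of the matchings -/

theorem ofNat_add {n : ℕ} [NeZero n] (a b : ℕ) :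
    Fin.ofNat n (a + b) = Fin.ofNat n a + Fin.ofNat n b := by
  ext; simp [Fin.val_add]

theorem mod_div_mod_four (x m c : ℕ) : x % (m * (4 * c)) / m % 4 = x / m % 4 := by
  rw [Nat.mod_mul_right_div_self, Nat.mod_mul_right_mod]

/-- Cut the positions into intervals of length `m`, numbered modulo `4`: the rotation `r` starts its
pairs precisely in the intervals of class `r`. -/
theorem mem_rotatedMatching_iff {n m c d k r : ℕ} [NeZero n] (hr : r < 4) (hm : 0 < m)
    (hn : n = m * (4 * c)) (h1 : n / 2 ^ (k + 1) = m) (h2 : n / 2 ^ (k - 1) = 4 * m)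
    (h3 : 2 ^ (k - 1) = c) (e : Sym2 (Fin n)) :
    e ∈ rotatedMatching n d k r ↔
      ∃ a : Fin n, (a : ℕ) / m % 4 = r ∧ s(a, a + Fin.ofNat n d) = e := by
  rw [h3] at h2
  simp only [rotatedMatching, baseMatching, shift, block, h1, h3, h2, Finset.mem_image,
    Finset.mem_biUnion, Finset.mem_range]
  constructor
  · rintro ⟨_, ⟨l, hl, _, ⟨i, hi, rfl⟩, rfl⟩, rfl⟩
    refine ⟨Fin.ofNat n (i + m * (4 * l + r)), ?_, ?_⟩
    · have : (Fin.ofNat n (i + m * (4 * l + r)) : ℕ) = (i + m * (4 * l + r)) % (m * (4 * c)) := by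
        rw [Fin.val_ofNat, hn]
      rw [this, mod_div_mod_four, Nat.add_mul_div_left _ _ hm, Nat.div_eq_of_lt hi]
      omega
    · have h : i + m * (4 * l + r) = i + l * (4 * m) + r * m := by ring
      simp only [Sym2.map_mk, h, ofNat_add]
      congr 1
      abel
  · rintro ⟨a, ha, rfl⟩
    have hac : (a : ℕ) / m / 4 < c := by
      rw [Nat.div_div_eq_div_mul, Nat.div_lt_iff_lt_mul (by positivity)]
      calc (a : ℕ) < n := a.2
        _ = c * (m * 4) := by rw [hn]; ring
    have h : (a : ℕ) = a % m + (a / m / 4) * (4 * m) + r * m := by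
      have e1 := Nat.mod_add_div (a : ℕ) m
      have e2 := Nat.mod_add_div ((a : ℕ) / m) 4
      rw [ha] at e2
      calc (a : ℕ) = a % m + m * (a / m) := e1.symm
        _ = a % m + m * (r + 4 * (a / m / 4)) := by rw [e2]
        _ = _ := by ring
    have h' : a = Fin.ofNat n (a % m + (a / m / 4) * (4 * m) + r * m) := by
      rw [← h]; ext; simp
    refine ⟨_, ⟨a / m / 4, hac, _, ⟨a % m, Nat.mod_lt _ hm, rfl⟩, rfl⟩, ?_⟩
    conv_rhs => rw [h']
    simp only [Sym2.map_mk, ofNat_add]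
    congr 1
    abel

/-- As `m ≤ d ≤ 2 * m`, adding `d` advances the interval number by `1` or `2`, or by `0` or `3`
never. Wrapping around is harmless since `4 * m` divides `n`. Hence no endpoint `a + d` lies in the
class of the starting points, which makes the pairs disjoint. -/
theorem add_ofNat_div_mod_ne {n m c d : ℕ} [NeZero n] (hm : 0 < m) (hn : n = m * (4 * c))
    (hd : m ≤ d) (hd' : d ≤ 2 * m) (a : Fin n) :
    ((a + Fin.ofNat n d : Fin n) : ℕ) / m % 4 ≠ (a : ℕ) / m % 4 := by
  have h : ((a + Fin.ofNat n d : Fin n) : ℕ) = (a + d) % (m * (4 * c)) := by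
    rw [Fin.val_add, Fin.val_ofNat, Nat.add_mod_mod, ← hn]
  rw [h, mod_div_mod_four]
  have h1 : (a : ℕ) / m + 1 ≤ (a + d) / m := by
    rw [← Nat.add_div_right _ hm]; exact Nat.div_le_div_right (by omega)
  have h2 : ((a : ℕ) + d) / m ≤ a / m + 2 := by
    rw [← Nat.add_mul_div_right _ _ hm]; exact Nat.div_le_div_right (by omega)
  omega

theorem isMatching_rotatedMatching {n m c d k r : ℕ} [NeZero n] (hr : r < 4) (hm : 0 < m)
    (hn : n = m * (4 * c)) (h1 : n / 2 ^ (k + 1) = m) (h2 : n / 2 ^ (k - 1) = 4 * m)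
    (h3 : 2 ^ (k - 1) = c) (hd : m ≤ d) (hd' : d ≤ 2 * m) :
    IsMatching (rotatedMatching n d k r) ∧ (rotatedMatching n d k r).card = c * m := by
  have hne := add_ofNat_div_mod_ne hm hn hd hd'
  have hmem := mem_rotatedMatching_iff (d := d) hr hm hn h1 h2 h3
  refine ⟨⟨fun e he => ?_, fun i e he f hf hie hif => ?_⟩, ?_⟩
  · obtain ⟨a, -, rfl⟩ := (hmem e).1 he
    rw [Sym2.mk_isDiag_iff]
    intro h
    exact hne a (by rw [← h])
  · obtain ⟨a, ha, rfl⟩ := (hmem e).1 he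
    obtain ⟨b, hb, rfl⟩ := (hmem f).1 hf
    rw [Sym2.mem_iff] at hie hif
    have hab : a = b := by
      rcases hie with rfl | rfl <;> rcases hif with h | h
      · exact h
      · exact absurd (h ▸ ha.trans hb.symm) (hne b)
      · exact absurd (h ▸ hb.trans ha.symm) (hne a)
      · exact add_right_cancel h
    rw [hab]
  · have himg : rotatedMatching n d k r =
        (Finset.univ.filter fun a : Fin n => (a : ℕ) / m % 4 = r).image
          fun a => s(a, a + Fin.ofNat n d) := by
      ext e; simp [hmem]
    rw [himg, Finset.card_image_of_injOn]
    · have : c * m = (Finset.range c ×ˢ Finset.range m).card := by simp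
      rw [this]
      have hlt : ∀ l i, l < c → i < m → i + m * (4 * l + r) < n := fun l i hl hi => by
        rw [hn]
        calc i + m * (4 * l + r) < m + m * (4 * l + r) := by omega
          _ = m * (4 * l + r + 1) := by ring
          _ ≤ m * (4 * c) := Nat.mul_le_mul_left _ (by omega)
      refine Finset.card_nbij' (fun a => ((a : ℕ) / m / 4, (a : ℕ) % m))
        (fun p => Fin.ofNat n (p.2 + m * (4 * p.1 + r))) ?_ ?_ ?_ ?_
      · intro a _
        simp only [Finset.coe_product, Set.mem_prod, Finset.coe_range, Set.mem_Iio]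
        refine ⟨?_, Nat.mod_lt _ hm⟩
        rw [Nat.div_div_eq_div_mul, Nat.div_lt_iff_lt_mul (by positivity)]
        calc (a : ℕ) < n := a.2
          _ = c * (m * 4) := by rw [hn]; ring
      · rintro ⟨l, i⟩ hp
        simp only [Finset.coe_product, Set.mem_prod, Finset.coe_range, Set.mem_Iio] at hp
        simp only [Finset.coe_filter, Finset.mem_univ, true_and]
        change (Fin.ofNat n _ : ℕ) / m % 4 = r
        rw [Fin.val_ofNat, Nat.mod_eq_of_lt (hlt l i hp.1 hp.2), Nat.add_mul_div_left _ _ hm,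
          Nat.div_eq_of_lt hp.2]
        omega
      · intro a ha
        have ha' : (a : ℕ) / m % 4 = r := by simpa using ha
        ext
        have e1 := Nat.mod_add_div (a : ℕ) m
        have e2 : 4 * ((a : ℕ) / m / 4) + r = a / m := by omega
        simp only [Fin.val_ofNat, e2, e1, Nat.mod_eq_of_lt a.2]
      · rintro ⟨l, i⟩ hp
        simp only [Finset.coe_product, Set.mem_prod, Finset.coe_range, Set.mem_Iio] at hp
        simp only [Fin.val_ofNat, Nat.mod_eq_of_lt (hlt l i hp.1 hp.2), Prod.mk.injEq]
        rw [Nat.add_mul_div_left _ _ hm, Nat.div_eq_of_lt hp.2, Nat.add_mul_mod_self_left,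
          Nat.mod_eq_of_lt hp.2]
        exact ⟨by omega, rfl⟩
    · intro a ha b hb hab
      have ha' : (a : ℕ) / m % 4 = r := by simpa using ha
      have hb' : (b : ℕ) / m % 4 = r := by simpa using hb
      rcases Sym2.eq_iff.1 hab with h | h
      · exact h.1
      · exact absurd (h.1 ▸ ha'.trans hb'.symm) (hne b)

/-- The size of a quarter of a block, at the scale `K = j + 1`. -/
def quarter (N j : ℕ) : ℕ := 2 ^ (N - 1 - min (j + 1) (N - 1))

theorem quarter_spec {N j : ℕ} (hN : 2 ≤ N) :
    0 < quarter N j ∧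
      2 ^ N = quarter N j * (4 * 2 ^ (min (j + 1) (N - 1) - 1)) ∧
      2 ^ N / 2 ^ (min (j + 1) (N - 1) + 1) = quarter N j ∧
      2 ^ N / 2 ^ (min (j + 1) (N - 1) - 1) = 4 * quarter N j := by
  have hk : min (j + 1) (N - 1) ≤ N - 1 := min_le_right _ _
  have hk' : 1 ≤ min (j + 1) (N - 1) := by omega
  unfold quarter
  generalize min (j + 1) (N - 1) = k at *
  refine ⟨by positivity, ?_, ?_, ?_⟩
  · have : N = (N - 1 - k) + 2 + (k - 1) := by omega
    conv_lhs => rw [this, pow_add, pow_add]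
    ring
  · rw [Nat.pow_div (by omega) (by norm_num)]; congr 1; omega
  · rw [Nat.pow_div (by omega) (by norm_num)]
    have : N - (k - 1) = (N - 1 - k) + 2 := by omega
    rw [this, pow_add]; ring

theorem two_pow_div_eq {N j : ℕ} (hj : j < N) :
    2 ^ N / 2 ^ (j + 1 + 1) = 2 ^ (N - 1 - j) / 2 ∧ 2 ^ N / 2 ^ (j + 1) = 2 ^ (N - 1 - j) := by
  have h : 2 ^ N / 2 ^ (j + 1) = 2 ^ (N - 1 - j) := by
    rw [Nat.pow_div (by omega) (by norm_num)]; congr 1; omega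
  exact ⟨by rw [pow_succ 2 (j + 1), ← Nat.div_div_eq_div_mul, h], h⟩

theorem quarter_le_of_mem {N j d : ℕ} (hN : 2 ≤ N) (hj : j < N)
    (hd : d ∈ Finset.Ioc (2 ^ N / 2 ^ (j + 1 + 1)) (2 ^ N / 2 ^ (j + 1))) :
    quarter N j ≤ d ∧ d ≤ 2 * quarter N j := by
  rw [Finset.mem_Ioc, (two_pow_div_eq hj).1, (two_pow_div_eq hj).2] at hd
  unfold quarter
  rcases lt_or_ge (j + 1) N with h | h
  · have h1 : N - 1 - j = (N - 1 - min (j + 1) (N - 1)) + 1 := by omega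
    rw [h1, pow_succ] at hd
    omega
  · have h1 : N - 1 - j = 0 := by omega
    have h2 : N - 1 - min (j + 1) (N - 1) = 0 := by omega
    rw [h1] at hd
    rw [h2]
    omega

theorem mem_rotatedMatching_pow_iff {N j d r : ℕ} (hN : 2 ≤ N) (hr : r < 4)
    (e : Sym2 (Fin (2 ^ N))) :
    e ∈ rotatedMatching (2 ^ N) d (min (j + 1) (N - 1)) r ↔
      ∃ a : Fin (2 ^ N), (a : ℕ) / quarter N j % 4 = r ∧ s(a, a + Fin.ofNat _ d) = e := by
  obtain ⟨h0, h1, h2, h3⟩ := quarter_spec (j := j) hN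
  exact mem_rotatedMatching_iff hr h0 h1 h2 h3 rfl e

/-- In `matchingLaw` the rotation is a natural number, drawn from the image of the uniform law on
`Fin 4`; here it ranges over `Fin 4` itself. -/
theorem matchingLaw_eq (N : ℕ) [NeZero N] :
    matchingLaw N = (PMF.uniformOfFintype (Fin N)).bind fun j =>
      (PMF.uniformOfFinset
        (Finset.Ioc (2 ^ N / 2 ^ ((j : ℕ) + 1 + 1)) (2 ^ N / 2 ^ ((j : ℕ) + 1)))
        (lengths_nonempty j.2)).bind fun d =>
          (PMF.uniformOfFintype (Fin 4)).map fun r : Fin 4 =>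
            rotatedMatching (2 ^ N) d (min ((j : ℕ) + 1) (N - 1)) (r : ℕ) := by
  unfold matchingLaw
  congr 1; funext j; congr 1; funext d
  change PMF.map _ ((PMF.uniformOfFintype (Fin 4)).bind fun a => PMF.pure (a : ℕ)) = _
  rw [PMF.map_bind]
  simp_rw [PMF.pure_map]
  rfl

theorem matchingLaw_support {N : ℕ} [NeZero N] (hN : 2 ≤ N) {M : Finset (Sym2 (Fin (2 ^ N)))}
    (hM : M ∈ (matchingLaw N).support) : IsMatching M ∧ (M.card : ℚ) = (2 : ℚ) ^ N / 4 := by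
  simp only [matchingLaw_eq, PMF.mem_support_bind_iff, PMF.mem_support_map_iff,
    PMF.mem_support_uniformOfFinset_iff] at hM
  obtain ⟨j, -, d, hd, r, -, rfl⟩ := hM
  obtain ⟨h0, h1, h2, h3⟩ := quarter_spec (j := (j : ℕ)) hN
  obtain ⟨hd1, hd2⟩ := quarter_le_of_mem hN j.2 hd
  obtain ⟨h4, h5⟩ := isMatching_rotatedMatching r.2 h0 h1 h2 h3 rfl hd1 hd2
  refine ⟨h4, ?_⟩
  rw [h5]
  have : (2 : ℚ) ^ N = (quarter N j : ℚ) * (4 * 2 ^ (min ((j : ℕ) + 1) (N - 1) - 1)) := by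
    exact_mod_cast h1
  rw [this]; push_cast; ring

/-! ### Probability that a given pair is compared -/

/-- The probability that the random matching contains the pair `{i, j}`. -/
noncomputable def pairProb {n : ℕ} (q : PMF (Finset (Sym2 (Fin n)))) (i j : Fin n) : ℝ≥0∞ :=
  q.toOuterMeasure {M | s(i, j) ∈ M}

open Classical in
theorem pairProb_matchingLaw (N : ℕ) [NeZero N] (a b : Fin (2 ^ N)) :
    pairProb (matchingLaw N) a b = ∑' j : Fin N, (N : ℝ≥0∞)⁻¹ * ∑' d : ℕ,
      PMF.uniformOfFinset
        (Finset.Ioc (2 ^ N / 2 ^ ((j : ℕ) + 1 + 1)) (2 ^ N / 2 ^ ((j : ℕ) + 1)))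
        (lengths_nonempty j.2) d *
      (((Finset.univ.filter fun r : Fin 4 =>
        s(a, b) ∈ rotatedMatching (2 ^ N) d (min ((j : ℕ) + 1) (N - 1)) r).card : ℝ≥0∞) / 4) := by
  simp only [pairProb, matchingLaw_eq, PMF.toOuterMeasure_bind_apply, PMF.toOuterMeasure_map_apply,
    PMF.uniformOfFintype_apply, Fintype.card_fin]
  refine tsum_congr fun j => congrArg _ (tsum_congr fun d => congrArg _ ?_)
  rw [PMF.toOuterMeasure_uniformOfFintype_apply, Fintype.card_fin, Fintype.card_subtype,
    Nat.cast_ofNat]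
  congr 3
  ext r
  rw [Finset.mem_filter, Finset.mem_filter]
  rfl

theorem exists_scale {N d : ℕ} (hd : 0 < d) (hd' : 2 * d ≤ 2 ^ N) : ∃ j : Fin N,
    d ∈ Finset.Ioc (2 ^ N / 2 ^ ((j : ℕ) + 1 + 1)) (2 ^ N / 2 ^ ((j : ℕ) + 1)) := by
  have hN : N ≠ 0 := by rintro rfl; simp at hd'; omega
  have hlt : Nat.clog 2 d ≤ N - 1 := by
    refine (Nat.clog_le_iff_le_pow (by norm_num)).2 ?_
    have : N = (N - 1) + 1 := by omega
    rw [this, pow_succ] at hd'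
    omega
  -- The scale whose largest length is the least power of two that is at least `d`.
  refine ⟨⟨N - 1 - Nat.clog 2 d, by omega⟩, ?_⟩
  rw [Finset.mem_Ioc, (two_pow_div_eq (by simp; omega)).1, (two_pow_div_eq (by simp; omega)).2]
  have : N - 1 - (N - 1 - Nat.clog 2 d) = Nat.clog 2 d := by omega
  simp only [this]
  refine ⟨?_, Nat.le_pow_clog (by norm_num) d⟩
  rcases Nat.eq_zero_or_pos (Nat.clog 2 d) with h | h
  · rw [h]; simpa using hd
  · have h1 : Nat.clog 2 d - 1 < Nat.clog 2 d := by omega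
    have h2 := (Nat.lt_clog_iff_pow_lt (by norm_num)).1 h1
    have h3 : Nat.clog 2 d = (Nat.clog 2 d - 1) + 1 := by omega
    rw [h3, pow_succ]
    simpa using h2

theorem scale_unique {N d j k : ℕ} (hj : j < N) (hk : k < N)
    (h : d ∈ Finset.Ioc (2 ^ N / 2 ^ (j + 1 + 1)) (2 ^ N / 2 ^ (j + 1)))
    (h' : d ∈ Finset.Ioc (2 ^ N / 2 ^ (k + 1 + 1)) (2 ^ N / 2 ^ (k + 1))) : j = k := by
  wlog hjk : j < k generalizing j k
  · rcases (not_lt.1 hjk).eq_or_lt with h1 | h1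
    · exact h1.symm
    · exact (this hk hj h' h h1).symm
  rw [Finset.mem_Ioc] at h h'
  have : 2 ^ N / 2 ^ (k + 1) ≤ 2 ^ N / 2 ^ (j + 1 + 1) :=
    Nat.div_le_div_left (Nat.pow_le_pow_right (by norm_num) (by omega)) (by positivity)
  omega

theorem card_scale_le {N d j : ℕ} (hj : j < N)
    (h : d ∈ Finset.Ioc (2 ^ N / 2 ^ (j + 1 + 1)) (2 ^ N / 2 ^ (j + 1))) :
    (Finset.Ioc (2 ^ N / 2 ^ (j + 1 + 1)) (2 ^ N / 2 ^ (j + 1))).card ≤ d ∧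
      d ≤ 2 * (Finset.Ioc (2 ^ N / 2 ^ (j + 1 + 1)) (2 ^ N / 2 ^ (j + 1))).card := by
  rw [Nat.card_Ioc]
  rw [Finset.mem_Ioc] at h
  rw [(two_pow_div_eq hj).1, (two_pow_div_eq hj).2] at *
  omega

/-- A pair more than `n / 2` apart is reached by wrapping around, with the shorter length `n - (b -
a)`. Only `d ≤ b - a` matters for a lower bound on the probability. -/
theorem exists_length {N : ℕ} {a b : Fin (2 ^ N)} (hab : a < b) : ∃ d : ℕ, 0 < d ∧
    2 * d ≤ 2 ^ N ∧ d ≤ (b : ℕ) - a ∧ ∃ e : Fin (2 ^ N), s(e, e + Fin.ofNat _ d) = s(a, b) := by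
  have hab' : (a : ℕ) < b := hab
  have hb := b.2
  rcases le_or_gt (2 * ((b : ℕ) - a)) (2 ^ N) with h | h
  · refine ⟨b - a, by omega, h, le_rfl, a, ?_⟩
    congr 1
    ext
    rw [Fin.val_add, Fin.val_ofNat, Nat.add_mod_mod, Nat.mod_eq_of_lt] <;> omega
  · refine ⟨2 ^ N - (b - a), by omega, by omega, by omega, b, ?_⟩
    rw [Sym2.eq_swap]
    congr 1
    ext
    rw [Fin.val_add, Fin.val_ofNat, Nat.add_mod_mod]
    have : (b : ℕ) + (2 ^ N - (b - a)) = a + 2 ^ N := by omega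
    rw [this, Nat.add_mod_right, Nat.mod_eq_of_lt a.2]

theorem le_pairProb {N : ℕ} [NeZero N] (hN : 2 ≤ N) {a b : Fin (2 ^ N)} (hab : a < b) :
    (N : ℝ≥0∞)⁻¹ * ((((b : ℕ) - a : ℕ) : ℝ≥0∞)⁻¹ * (1 / 4)) ≤ pairProb (matchingLaw N) a b := by
  classical
  obtain ⟨d, hd0, hd1, hd2, e, he⟩ := exists_length hab
  obtain ⟨j, hj⟩ := exists_scale hd0 hd1
  rw [pairProb_matchingLaw]
  refine le_trans ?_ (ENNReal.le_tsum j)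
  gcongr
  refine le_trans ?_ (ENNReal.le_tsum d)
  rw [PMF.uniformOfFinset_apply_of_mem _ hj]
  gcongr
  · exact (card_scale_le j.2 hj).1.trans hd2
  · rw [Nat.one_le_cast, Nat.one_le_iff_ne_zero, ← Nat.pos_iff_ne_zero, Finset.card_pos]
    refine ⟨⟨(e : ℕ) / quarter N j % 4, Nat.mod_lt _ (by norm_num)⟩, ?_⟩
    rw [Finset.mem_filter]
    exact ⟨Finset.mem_univ _,
      (mem_rotatedMatching_pow_iff hN (Nat.mod_lt _ (by norm_num)) _).2 ⟨e, rfl, he⟩⟩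

/-- In the left half no wrap-around can produce the pair, so the length must be `b - a` and the
rotation must be the class of `a`: one term of the triple sum survives. -/
theorem pairProb_le {N : ℕ} [NeZero N] (hN : 2 ≤ N) {a b : Fin (2 ^ N)} (hab : a < b)
    (hb : 2 * (b : ℕ) < 2 ^ N) :
    pairProb (matchingLaw N) a b ≤ (N : ℝ≥0∞)⁻¹ * (2 * (((b : ℕ) - a : ℕ) : ℝ≥0∞)⁻¹ * (1 / 4)) := by
  classical
  have hab' : (a : ℕ) < b := hab
  obtain ⟨j, hj⟩ := exists_scale (N := N) (d := b - a) (by omega) (by omega)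
  have hkey : ∀ (k : Fin N) (d : ℕ),
      d ∈ Finset.Ioc (2 ^ N / 2 ^ ((k : ℕ) + 1 + 1)) (2 ^ N / 2 ^ ((k : ℕ) + 1)) → ∀ r : Fin 4,
      s(a, b) ∈ rotatedMatching (2 ^ N) d (min ((k : ℕ) + 1) (N - 1)) r →
      d = b - a ∧ k = j ∧ (a : ℕ) / quarter N k % 4 = r := fun k d hd r hr => by
    obtain ⟨e, he, hed⟩ := (mem_rotatedMatching_pow_iff hN r.2 _).1 hr
    have hdN : 2 * d ≤ 2 ^ N := by
      rw [Finset.mem_Ioc, (two_pow_div_eq k.2).2] at hd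
      have : 2 ^ N = 2 ^ (N - 1 - k) * 2 * 2 ^ (k : ℕ) := by
        rw [← pow_succ, ← pow_add]; congr 1; omega
      have h1 : 1 ≤ 2 ^ (k : ℕ) := Nat.one_le_two_pow
      nlinarith [hd.2, Nat.zero_le (2 ^ (N - 1 - (k : ℕ)))]
    have hd0 : 0 < d := (Nat.zero_le _).trans_lt (Finset.mem_Ioc.1 hd).1
    have hval : ∀ u v : Fin (2 ^ N), u + Fin.ofNat _ d = v → 2 * (u : ℕ) < 2 ^ N →
        (v : ℕ) = u + d := fun u v huv hu => by
      rw [← huv, Fin.val_add, Fin.val_ofNat, Nat.add_mod_mod, Nat.mod_eq_of_lt (by omega)]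
    rcases Sym2.eq_iff.1 hed with ⟨rfl, h2⟩ | ⟨rfl, h2⟩
    · have := hval _ _ h2 (by omega)
      have hdb : d = b - e := by omega
      subst hdb
      exact ⟨rfl, Fin.ext (scale_unique k.2 j.2 hd hj), he⟩
    · have := hval _ _ h2 hb
      omega
  rw [pairProb_matchingLaw, tsum_eq_single j]
  · gcongr
    rw [tsum_eq_single ((b : ℕ) - a)]
    · rw [PMF.uniformOfFinset_apply_of_mem _ hj]
      gcongr
      · rw [← div_eq_mul_inv, ENNReal.le_div_iff_mul_le (by left; norm_cast; omega) (by simp),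
          mul_comm, ← div_eq_mul_inv]
        refine ENNReal.div_le_of_le_mul ?_
        exact_mod_cast (card_scale_le j.2 hj).2
      · rw [Nat.cast_le_one, Finset.card_le_one]
        intro r hr r' hr'
        rw [Finset.mem_filter] at hr hr'
        exact Fin.ext ((hkey j _ hj r hr.2).2.2.symm.trans (hkey j _ hj r' hr'.2).2.2)
    · intro d hd
      by_cases hdj : d ∈ Finset.Ioc (2 ^ N / 2 ^ ((j : ℕ) + 1 + 1)) (2 ^ N / 2 ^ ((j : ℕ) + 1))
      · rw [Finset.filter_false_of_mem fun r _ hr => hd (hkey j d hdj r hr).1]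
        simp
      · rw [PMF.uniformOfFinset_apply_of_notMem _ hdj, zero_mul]
  · intro k hk
    have : ∀ d : ℕ, PMF.uniformOfFinset
        (Finset.Ioc (2 ^ N / 2 ^ ((k : ℕ) + 1 + 1)) (2 ^ N / 2 ^ ((k : ℕ) + 1)))
        (lengths_nonempty k.2) d *
      (((Finset.univ.filter fun r : Fin 4 =>
        s(a, b) ∈ rotatedMatching (2 ^ N) d (min ((k : ℕ) + 1) (N - 1)) r).card : ℝ≥0∞) / 4) = 0 :=
      fun d => by
        by_cases hdj : d ∈ Finset.Ioc (2 ^ N / 2 ^ ((k : ℕ) + 1 + 1)) (2 ^ N / 2 ^ ((k : ℕ) + 1))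
        · rw [Finset.filter_false_of_mem fun r _ hr => hk (hkey k d hdj r hr).2.1]
          simp
        · rw [PMF.uniformOfFinset_apply_of_notMem _ hdj, zero_mul]
    simp_rw [this, tsum_zero, mul_zero]


/-! ### Upper bound: decay of the expected disorder -/

theorem sum_toReal_eq_one {ι : Type*} [Fintype ι] (q : PMF ι) : ∑ M, (q M).toReal = 1 := by
  rw [← ENNReal.toReal_sum fun M _ => q.apply_ne_top M, ← tsum_fintype (L := .unconditional _),
    q.tsum_coe, ENNReal.toReal_one]

theorem sum_mul_ofReal {ι : Type*} [Fintype ι] (q : PMF ι) {a : ι → ℝ} (ha : ∀ M, 0 ≤ a M) :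
    ∑ M, q M * ENNReal.ofReal (a M) = ENNReal.ofReal (∑ M, (q M).toReal * a M) := by
  rw [ENNReal.ofReal_sum_of_nonneg fun M _ => mul_nonneg ENNReal.toReal_nonneg (ha M)]
  refine Finset.sum_congr rfl fun M _ => ?_
  rw [ENNReal.ofReal_mul ENNReal.toReal_nonneg, ENNReal.ofReal_toReal (q.apply_ne_top M)]

open Classical in
theorem sum_toReal_mul_ite {n : ℕ} (q : PMF (Finset (Sym2 (Fin n)))) (i j : Fin n) (v : ℝ) :
    ∑ M, (q M).toReal * (if s(i, j) ∈ M then v else 0) = (pairProb q i j).toReal * v := by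
  have : pairProb q i j = ∑ M, if s(i, j) ∈ M then q M else 0 := by
    rw [pairProb, PMF.toOuterMeasure_apply, tsum_fintype]
    exact Finset.sum_congr rfl fun M _ => by 
      rw [Set.indicator_apply]; simp only [Set.mem_ofPred_eq]
  rw [this, ENNReal.toReal_sum fun M _ => by split_ifs <;> simp [q.apply_ne_top], Finset.sum_mul]
  refine Finset.sum_congr rfl fun M _ => ?_
  split_ifs <;> simp

open Classical in
theorem sum_toReal_mul_sum_ite {n : ℕ} (q : PMF (Finset (Sym2 (Fin n)))) (v : Fin n → Fin n → ℝ) :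
    ∑ M, (q M).toReal * ∑ i, ∑ j, (if s(i, j) ∈ M then v i j else 0) =
      ∑ i, ∑ j, (pairProb q i j).toReal * v i j := by
  simp_rw [Finset.mul_sum]
  rw [Finset.sum_comm]
  refine Finset.sum_congr rfl fun i _ => ?_
  rw [Finset.sum_comm]
  exact Finset.sum_congr rfl fun j _ => sum_toReal_mul_ite q i j _

/-- If every pair `{i, j}` is compared with probability at least `c / |i - j|`, then a round
multiplies the expected disorder by at most `1 - c`. -/
theorem sum_mul_disorder_le {n : ℕ} {α : Type*} [LinearOrder α] {q : PMF (Finset (Sym2 (Fin n)))}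
    (hq : ∀ M ∈ q.support, IsMatching M) {c : ℝ} (hc : c ≤ 1)
    (hP : ∀ i j : Fin n, i < j → c ≤ (pairProb q i j).toReal * ((j : ℝ) - i))
    {h : α → ℝ} (hh : Monotone h) (y : Fin n → α) :
    ∑ M, q M * ENNReal.ofReal (disorder (h ∘ sortAlong M y)) ≤
      ENNReal.ofReal (1 - c) * ENNReal.ofReal (disorder (h ∘ y)) := by
  classical
  rw [sum_mul_ofReal q fun _ => disorder_nonneg _, ← ENNReal.ofReal_mul (by linarith)]
  refine ENNReal.ofReal_le_ofReal ?_
  have hstep : ∀ M, (q M).toReal * disorder (h ∘ sortAlong M y) =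
      (q M).toReal * disorder (h ∘ y) - (q M).toReal * ∑ i : Fin n, ∑ j : Fin n,
        if s(i, j) ∈ M then
          (if i < j then ((j : ℝ) - i) * max (h (y i) - h (y j)) 0 else 0) else 0 := fun M => by
    -- Outside the support `M` need not be a matching, but its probability vanishes.
    by_cases hM : M ∈ q.support
    · rw [disorder_sortAlong (hq M hM) y hh, mul_sub]
    · rw [PMF.mem_support_iff, not_not] at hM
      simp [hM]
  simp_rw [hstep, Finset.sum_sub_distrib]
  rw [sum_toReal_mul_sum_ite, ← Finset.sum_mul, sum_toReal_eq_one, sub_mul]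
  refine sub_le_sub_left ?_ _
  rw [disorder, Finset.mul_sum]
  refine Finset.sum_le_sum fun i _ => ?_
  rw [Finset.mul_sum]
  refine Finset.sum_le_sum fun j _ => ?_
  split_ifs with hij
  · rw [← mul_assoc]
    exact mul_le_mul_of_nonneg_right (hP i j hij) (le_max_right _ _)
  · simp

/-- The number of entries of the list `x` below a given value. -/
noncomputable def rank {n : ℕ} {α : Type*} [LinearOrder α] (x : Fin n → α) (v : α) : ℝ :=
  ((Finset.univ.filter fun k => x k < v).card : ℝ)

theorem rank_mono {n : ℕ} {α : Type*} [LinearOrder α] (x : Fin n → α) : Monotone (rank x) :=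
  fun _ _ huv => Nat.cast_le.2 <| Finset.card_le_card <|
    Finset.monotone_filter_right _ fun _ _ hk => lt_of_lt_of_le hk huv

theorem rank_add_one_le {n : ℕ} {α : Type*} [LinearOrder α] (x : Fin n → α) {k : Fin n} {v : α}
    (hv : x k < v) : rank x (x k) + 1 ≤ rank x v := by
  unfold rank
  norm_cast
  refine Nat.succ_le_of_lt (Finset.card_lt_card ?_)
  refine Finset.ssubset_iff_of_subset
    (Finset.monotone_filter_right _ fun _ _ hj => lt_trans hj hv) |>.2 ⟨k, ?_, ?_⟩ <;> simp [hv]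

theorem rank_le {n : ℕ} {α : Type*} [LinearOrder α] (x : Fin n → α) (v : α) : rank x v ≤ n := by
  unfold rank
  exact_mod_cast (Finset.card_le_univ _).trans_eq (Fintype.card_fin n)

theorem disorder_rank_le {n : ℕ} {α : Type*} [LinearOrder α] (x : Fin n → α) :
    disorder (rank x ∘ x) ≤ (n : ℝ) ^ 3 := by
  have : ∀ i j : Fin n,
      (if i < j then max ((rank x ∘ x) i - (rank x ∘ x) j) 0 else 0) ≤ (n : ℝ) := fun i j => by
    have h1 := rank_le x (x i)
    have h2 : 0 ≤ rank x (x j) := Nat.cast_nonneg _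
    split_ifs
    · exact max_le (by simp only [Function.comp_apply]; linarith) (Nat.cast_nonneg _)
    · exact Nat.cast_nonneg _
  calc _ ≤ ∑ _i : Fin n, ∑ _j : Fin n, (n : ℝ) :=
        Finset.sum_le_sum fun i _ => Finset.sum_le_sum fun j _ => this i j
    _ = (n : ℝ) ^ 3 := by simp; ring

/-- Ranks of distinct values differ by at least `1`, so a single inversion already contributes `1`.
-/
theorem one_le_disorder_rank {n : ℕ} {α : Type*} [LinearOrder α] (x : Fin n → α)
    (σ : Equiv.Perm (Fin n)) (h : ¬ Monotone (x ∘ σ)) : 1 ≤ disorder (rank x ∘ x ∘ σ) := by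
  have : ∃ i j, i < j ∧ x (σ j) < x (σ i) := by
    by_contra! hc
    exact h (monotone_iff_forall_lt.2 fun i j hij => hc i j hij)
  obtain ⟨i, j, hij, hlt⟩ := this
  have h1 := rank_add_one_le x hlt
  have hnn : ∀ i j : Fin n, 0 ≤ (if i < j then
      max ((rank x ∘ x ∘ σ) i - (rank x ∘ x ∘ σ) j) 0 else 0) := fun i j => by
    split_ifs <;> simp
  calc (1 : ℝ) ≤ if i < j then max ((rank x ∘ x ∘ σ) i - (rank x ∘ x ∘ σ) j) 0 else 0 := by
        rw [if_pos hij]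
        exact le_max_of_le_left (by simp only [Function.comp_apply]; linarith)
    _ ≤ ∑ j, if i < j then max ((rank x ∘ x ∘ σ) i - (rank x ∘ x ∘ σ) j) 0 else 0 :=
        Finset.single_le_sum (f := fun j => if i < j then
          max ((rank x ∘ x ∘ σ) i - (rank x ∘ x ∘ σ) j) 0 else 0) (fun j _ => hnn i j)
          (Finset.mem_univ j)
    _ ≤ _ := Finset.single_le_sum (f := fun i => ∑ j, if i < j then
          max ((rank x ∘ x ∘ σ) i - (rank x ∘ x ∘ σ) j) 0 else 0)
          (fun i _ => Finset.sum_nonneg fun j _ => hnn i j) (Finset.mem_univ i)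

theorem measure_not_monotone_le {n : ℕ} {α : Type*} [LinearOrder α]
    {q : PMF (Finset (Sym2 (Fin n)))} (hq : ∀ M ∈ q.support, IsMatching M) {c : ℝ} (hc : c ≤ 1)
    (hP : ∀ i j : Fin n, i < j → c ≤ (pairProb q i j).toReal * ((j : ℝ) - i))
    (x : Fin n → α) (t : ℕ) :
    roundsLaw q {ω | ¬ Monotone (state ω x t)} ≤
      ENNReal.ofReal (1 - c) ^ t * ENNReal.ofReal ((n : ℝ) ^ 3) := by
  refine (measure_state_le q x (fun y => ENNReal.ofReal (disorder (rank x ∘ y)))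
    (sum_mul_disorder_le hq hc hP (rank_mono x)) (fun y => ¬ Monotone y) (fun σ h => ?_) hq t).trans
    ?_
  · rw [ENNReal.one_le_ofReal]
    exact one_le_disorder_rank x σ h
  · gcongr
    exact disorder_rank_le x

theorem le_pairProb_toReal_mul {N : ℕ} [NeZero N] (hN : 2 ≤ N) {a b : Fin (2 ^ N)} (hab : a < b) :
    1 / (4 * (N : ℝ)) ≤ (pairProb (matchingLaw N) a b).toReal * ((b : ℝ) - a) := by
  have hab' : (a : ℕ) < b := hab
  have hfin : pairProb (matchingLaw N) a b ≠ ⊤ := by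
    unfold pairProb
    rw [← PMF.toMeasure_apply_eq_toOuterMeasure]
    exact measure_ne_top _ _
  have h := ENNReal.toReal_mono hfin (le_pairProb hN hab)
  have hpos : (0 : ℝ) < (b : ℝ) - a := by
    rw [sub_pos]; exact_mod_cast hab'
  have hN' : (0 : ℝ) < N := by positivity
  simp only [ENNReal.toReal_mul, ENNReal.toReal_inv, ENNReal.toReal_natCast, one_div,
    ENNReal.toReal_ofNat] at h
  rw [Nat.cast_sub hab'.le] at h
  calc 1 / (4 * (N : ℝ)) = (N : ℝ)⁻¹ * (((b : ℝ) - a)⁻¹ * 4⁻¹) * ((b : ℝ) - a) := by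
        field_simp
    _ ≤ _ := by gcongr

theorem pairProb_toReal_le {N : ℕ} [NeZero N] (hN : 2 ≤ N) {a b : Fin (2 ^ N)} (hab : a < b)
    (hb : 2 * (b : ℕ) < 2 ^ N) :
    (pairProb (matchingLaw N) a b).toReal ≤ 1 / (2 * (N : ℝ)) * (1 / ((b : ℝ) - a)) := by
  have hab' : (a : ℕ) < b := hab
  have hpos : (0 : ℝ) < (b : ℝ) - a := by
    rw [sub_pos]; exact_mod_cast hab'
  have hN' : (0 : ℝ) < N := by positivity
  have h0 : (((b : ℕ) - a : ℕ) : ℝ≥0∞) ≠ 0 := by norm_cast; omega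
  have h1 : (N : ℝ≥0∞) ≠ 0 := by norm_cast; omega
  have h := ENNReal.toReal_mono (by finiteness) (pairProb_le hN hab hb)
  simp only [ENNReal.toReal_mul, ENNReal.toReal_inv, ENNReal.toReal_natCast, one_div,
    ENNReal.toReal_ofNat] at h
  rw [Nat.cast_sub hab'.le] at h
  refine h.trans_eq ?_
  field_simp
  norm_num

/-! ### Lower bound: slow growth of the weight of the smallest entry -/

theorem sum_one_div_sqrt_le (m : ℕ) : ∑ i ∈ Finset.range m, 1 / √((i : ℝ) + 1) ≤ 2 * √m := by
  induction m with
  | zero => simp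
  | succ m ih =>
    rw [Finset.sum_range_succ]
    refine (add_le_add_left ih _).trans ?_
    have h1 : 0 < √((m : ℝ) + 1) := by positivity
    have h2 := Real.sq_sqrt (show (0 : ℝ) ≤ (m : ℝ) + 1 by positivity)
    have h3 := Real.sq_sqrt (show (0 : ℝ) ≤ (m : ℝ) by positivity)
    rw [← le_sub_iff_add_le', div_le_iff₀ h1]
    push_cast
    nlinarith [sq_nonneg (√((m : ℝ) + 1) - √(m : ℝ))]

/-- With `a = √(i + 1)` and `b = √(m + 1)` the distance `m - i` is `b ^ 2 - a ^ 2`, so the singular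
factor `b - a` cancels and each term is `1 / (a * b * (a + b)) ≤ 1 / (a * b ^ 2)`. The sum of `1 /
a` is at most `2 * b`. -/
theorem sum_sqrt_jump_le (m : ℕ) :
    ∑ i ∈ Finset.range m, 1 / ((m : ℝ) - i) * (1 / √((i : ℝ) + 1) - 1 / √((m : ℝ) + 1)) ≤
      2 * (1 / √((m : ℝ) + 1)) := by
  have hb : 0 < √((m : ℝ) + 1) := by positivity
  have hb2 := Real.sq_sqrt (show (0 : ℝ) ≤ (m : ℝ) + 1 by positivity)
  have hterm : ∀ i ∈ Finset.range m,
      1 / ((m : ℝ) - i) * (1 / √((i : ℝ) + 1) - 1 / √((m : ℝ) + 1)) ≤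
        1 / √((i : ℝ) + 1) * (1 / ((m : ℝ) + 1)) := fun i hi => by
    have him : (i : ℝ) < m := by exact_mod_cast Finset.mem_range.1 hi
    have ha : 0 < √((i : ℝ) + 1) := by positivity
    have ha2 := Real.sq_sqrt (show (0 : ℝ) ≤ (i : ℝ) + 1 by positivity)
    have hab : √((i : ℝ) + 1) < √((m : ℝ) + 1) := Real.sqrt_lt_sqrt (by positivity) (by linarith)
    have hd : (m : ℝ) - i = √((m : ℝ) + 1) ^ 2 - √((i : ℝ) + 1) ^ 2 := by rw [hb2, ha2]; ring
    rw [hd, ← hb2]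
    have e : √(√((m : ℝ) + 1) ^ 2) = √((m : ℝ) + 1) := Real.sqrt_sq hb.le
    rw [e]
    generalize √((m : ℝ) + 1) = b at *
    generalize √((i : ℝ) + 1) = a at *
    have hba : b - a ≠ 0 := by linarith
    have hba' : b + a ≠ 0 := by positivity
    have : 1 / (b ^ 2 - a ^ 2) * (1 / a - 1 / b) = 1 / a * (1 / (b * (b + a))) := by
      have : b ^ 2 - a ^ 2 = (b - a) * (b + a) := by ring
      rw [this]; field_simp
    rw [this]
    gcongr
    nlinarith
  refine (Finset.sum_le_sum hterm).trans ?_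
  rw [← Finset.sum_mul]
  calc _ ≤ 2 * √m * (1 / ((m : ℝ) + 1)) := by gcongr; exact sum_one_div_sqrt_le m
    _ ≤ 2 * √((m : ℝ) + 1) * (1 / ((m : ℝ) + 1)) := by gcongr; linarith
    _ = 2 * (1 / √((m : ℝ) + 1)) := by
      conv_lhs => enter [2]; rw [← hb2]
      field_simp


/-- The weight of a small entry in position `i`, for the lower bound. -/
noncomputable def smallWeight {n : ℕ} (i : Fin n) : ℝ :=
  if 2 * (i : ℕ) < n then 1 / √((i : ℝ) + 1) else 1

theorem smallWeight_nonneg {n : ℕ} (i : Fin n) : 0 ≤ smallWeight i := by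
  unfold smallWeight; split_ifs <;> positivity

theorem smallWeight_le_one {n : ℕ} (i : Fin n) : smallWeight i ≤ 1 := by
  unfold smallWeight
  split_ifs
  · rw [div_le_one (by positivity)]
    exact Real.one_le_sqrt.2 (by simp)
  · exact le_rfl

theorem sum_smallWeight_jump_le {n : ℕ} {j : Fin n} (hj : 2 * (j : ℕ) < n) :
    ∑ i : Fin n, (if i < j then 1 / ((j : ℝ) - i) * (smallWeight i - smallWeight j) else 0) ≤
      2 * smallWeight j := by
  have hw : ∀ i : Fin n, i ≤ j → smallWeight i = 1 / √(((i : ℕ) : ℝ) + 1) := fun i hi =>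
    if_pos (by have : (i : ℕ) ≤ j := hi; omega)
  rw [hw j le_rfl]
  refine le_trans (le_of_eq ?_) (sum_sqrt_jump_le j)
  have h1 := Fin.sum_univ_eq_sum_range (fun i : ℕ => if i < (j : ℕ) then
    1 / (((j : ℕ) : ℝ) - (i : ℝ)) * (1 / √((i : ℝ) + 1) - 1 / √(((j : ℕ) : ℝ) + 1)) else 0) n
  have h2 : (Finset.range n).filter (fun i => i < (j : ℕ)) = Finset.range j := by
    ext i; simp only [Finset.mem_filter, Finset.mem_range]; omega
  rw [← h2, Finset.sum_filter, ← h1]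
  refine Finset.sum_congr rfl fun i _ => ?_
  by_cases hij : i < j
  · rw [if_pos hij, if_pos (show (i : ℕ) < j from hij), hw i hij.le]
  · rw [if_neg hij, if_neg (show ¬ (i : ℕ) < j from hij)]

/-- If pairs `i < j < n / 2` are compared with probability at most `c / (2 |i - j|)`, then a round
multiplies the expected total weight of the small entries by at most `1 + c`. -/
theorem sum_mul_smallWeight_le {n : ℕ} {α : Type*} [LinearOrder α]
    {q : PMF (Finset (Sym2 (Fin n)))} (hq : ∀ M ∈ q.support, IsMatching M) {c : ℝ} (hc : 0 ≤ c)
    (hP : ∀ i j : Fin n, i < j → 2 * (j : ℕ) < n →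
      (pairProb q i j).toReal ≤ c / 2 * (1 / ((j : ℝ) - i)))
    {h : α → ℝ} (hh : Monotone h) (h1 : ∀ v, h v ≤ 1) (y : Fin n → α) :
    ∑ M, q M * ENNReal.ofReal (∑ i, smallWeight i * (1 - h (sortAlong M y i))) ≤
      ENNReal.ofReal (1 + c) * ENNReal.ofReal (∑ i, smallWeight i * (1 - h (y i))) := by
  classical
  rw [sum_mul_ofReal q fun M => Finset.sum_nonneg fun i _ =>
    mul_nonneg (smallWeight_nonneg i) (sub_nonneg.2 (h1 _)), ← ENNReal.ofReal_mul (by linarith)]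
  refine ENNReal.ofReal_le_ofReal ?_
  have hstep : ∀ M, (q M).toReal * ∑ i, smallWeight i * (1 - h (sortAlong M y i)) =
      (q M).toReal * (∑ i, smallWeight i * (1 - h (y i))) +
      (q M).toReal * ∑ i : Fin n, ∑ j : Fin n, if s(i, j) ∈ M then (if i < j then
        (smallWeight i - smallWeight j) * max (h (y i) - h (y j)) 0 else 0) else 0 := fun M => by
    by_cases hM : M ∈ q.support
    · rw [← mul_add]
      congr 1
      have := sum_mul_sortAlong (hq M hM) y hh smallWeight
      simp_rw [mul_sub, Finset.sum_sub_distrib]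
      rw [this, ← sub_sub, sub_eq_add_neg _ (∑ i, ∑ j, _)]
      congr 1
      rw [← Finset.sum_neg_distrib]
      refine Finset.sum_congr rfl fun i _ => ?_
      rw [← Finset.sum_neg_distrib]
      exact Finset.sum_congr rfl fun j _ => by split_ifs <;> ring
    · rw [PMF.mem_support_iff, not_not] at hM
      simp [hM]
  simp_rw [hstep, Finset.sum_add_distrib]
  rw [sum_toReal_mul_sum_ite, ← Finset.sum_mul, sum_toReal_eq_one, add_mul]
  refine add_le_add_right ?_ _
  rw [Finset.sum_comm, Finset.mul_sum]
  refine Finset.sum_le_sum fun j _ => ?_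
  have hj1 : 0 ≤ 1 - h (y j) := sub_nonneg.2 (h1 _)
  have hmax : ∀ i, max (h (y i) - h (y j)) 0 ≤ 1 - h (y j) := fun i =>
    max_le (by linarith [h1 (y i)]) hj1
  by_cases hj : 2 * (j : ℕ) < n
  · calc _ ≤ ∑ i, (c / 2 * (1 - h (y j))) *
          (if i < j then 1 / ((j : ℝ) - i) * (smallWeight i - smallWeight j) else 0) := by
          refine Finset.sum_le_sum fun i _ => ?_
          split_ifs with hij
          · have hij' : (i : ℕ) < j := hij
            have hd : 0 ≤ smallWeight i - smallWeight j := by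
              rw [sub_nonneg, smallWeight, smallWeight, if_pos hj, if_pos (by omega)]
              gcongr
            have hpos : (0 : ℝ) ≤ 1 / ((j : ℝ) - i) := by
              rw [one_div_nonneg, sub_nonneg]; exact_mod_cast hij'.le
            calc _ ≤ c / 2 * (1 / ((j : ℝ) - i)) *
                  ((smallWeight i - smallWeight j) * (1 - h (y j))) := by
                  refine mul_le_mul (hP i j hij hj) ?_ ?_ ?_
                  · exact mul_le_mul_of_nonneg_left (hmax i) hd
                  · exact mul_nonneg hd (le_max_right _ _)
                  · positivity
              _ = _ := by ring
          · simp
      _ = (c / 2 * (1 - h (y j))) * ∑ i : Fin n,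
          (if i < j then 1 / ((j : ℝ) - i) * (smallWeight i - smallWeight j) else 0) := by
          rw [Finset.mul_sum]
      _ ≤ (c / 2 * (1 - h (y j))) * (2 * smallWeight j) :=
          mul_le_mul_of_nonneg_left (sum_smallWeight_jump_le hj) (by positivity)
      _ = _ := by ring
  -- In the right half the weight has its maximal value `1`, so leaving `j` cannot increase it and
  -- no bound on the probability is needed.
  · refine le_trans (Finset.sum_nonpos fun i _ => ?_)
      (mul_nonneg hc (mul_nonneg (smallWeight_nonneg j) hj1))
    refine mul_nonpos_of_nonneg_of_nonpos ENNReal.toReal_nonneg ?_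
    split_ifs
    · refine mul_nonpos_of_nonpos_of_nonneg ?_ (le_max_right _ _)
      have : smallWeight j = 1 := if_neg hj
      linarith [smallWeight_le_one i]
    · exact le_rfl

/-- Starting with the smallest entry in position `p < n / 2`, the probability of being sorted
early is small. -/
theorem measure_monotone_le {n : ℕ} [NeZero n] {q : PMF (Finset (Sym2 (Fin n)))}
    (hq : ∀ M ∈ q.support, IsMatching M) {c : ℝ} (hc : 0 ≤ c)
    (hP : ∀ i j : Fin n, i < j → 2 * (j : ℕ) < n →
      (pairProb q i j).toReal ≤ c / 2 * (1 / ((j : ℝ) - i)))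
    (p : Fin n) (hp : 2 * (p : ℕ) < n) (t : ℕ) :
    roundsLaw q {ω | Monotone (state ω (Equiv.swap 0 p) t)} ≤
      ENNReal.ofReal (1 + c) ^ t * ENNReal.ofReal (1 / √((p : ℝ) + 1)) := by
  -- `1 - h` is the indicator of the smallest entry.
  let h : Fin n → ℝ := fun v => if v = 0 then 0 else 1
  have h1 : ∀ v, h v ≤ 1 := fun v => by simp only [h]; split_ifs <;> norm_num
  have hh : Monotone h := fun u v huv => by
    by_cases hv : v = 0
    · have hu : u = 0 := by
        rw [hv] at huv
        exact le_antisymm huv (Fin.zero_le _)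
      rw [hu, hv]
    · refine (h1 u).trans_eq ?_
      simp [h, hv]
  have hterm : ∀ v, 1 - h v = if v = 0 then 1 else 0 := fun v => by
    simp only [h]; split_ifs <;> norm_num
  refine (measure_state_le q _
    (fun y : Fin n → Fin n => ENNReal.ofReal (∑ i, smallWeight i * (1 - h (y i))))
    (sum_mul_smallWeight_le hq hc hP hh h1) Monotone (fun σ hσ => ?_) hq t).trans ?_
  · rw [ENNReal.one_le_ofReal]
    have hz : (Equiv.swap 0 p ∘ σ) 0 = 0 := by
      have := hσ (Fin.zero_le (σ.symm (Equiv.swap 0 p 0)))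
      simp only [Function.comp_apply, Equiv.apply_symm_apply, Equiv.swap_apply_left,
        Equiv.swap_apply_right] at this ⊢
      exact le_antisymm this (Fin.zero_le _)
    have hw : smallWeight (0 : Fin n) = 1 := by
      simp [smallWeight]
    calc (1 : ℝ) = smallWeight (0 : Fin n) * (1 - h ((Equiv.swap 0 p ∘ σ) 0)) := by
          rw [hz, hw, hterm, if_pos rfl, mul_one]
      _ ≤ _ := Finset.single_le_sum
          (f := fun i => smallWeight i * (1 - h ((Equiv.swap 0 p ∘ σ) i)))
          (fun i _ => mul_nonneg (smallWeight_nonneg i) (sub_nonneg.2 (h1 _))) (Finset.mem_univ _)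
  · gcongr
    rw [Finset.sum_eq_single p]
    · rw [hterm, Equiv.swap_apply_right, if_pos rfl, mul_one, smallWeight, if_pos hp]
    · intro i _ hi
      rw [hterm, if_neg, mul_zero]
      intro h
      apply hi
      exact (Equiv.swap 0 p).injective (h.trans (Equiv.swap_apply_right 0 p).symm)
    · simp


/-! ### Explicit constants for `matchingLaw` -/

theorem measure_not_monotone_matchingLaw_le {N : ℕ} [NeZero N] (hN : 2 ≤ N) {α : Type*}
    [LinearOrder α] (x : Fin (2 ^ N) → α) (t : ℕ) :
    roundsLaw (matchingLaw N) {ω | ¬ Monotone (state ω x t)} ≤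
      ENNReal.ofReal (1 - 1 / (4 * (N : ℝ))) ^ t *
        ENNReal.ofReal (Real.exp (3 * (N * Real.log 2))) := by
  have hN' : (2 : ℝ) ≤ N := by exact_mod_cast hN
  have h := measure_not_monotone_le (fun M hM => (matchingLaw_support hN hM).1)
    (c := 1 / (4 * (N : ℝ))) (by rw [div_le_one (by positivity)]; linarith)
    (fun i j hij => le_pairProb_toReal_mul hN hij) x t
  refine h.trans_eq ?_
  congr 2
  have h2 : (2 : ℝ) ^ N = Real.exp (N * Real.log 2) := by
    rw [Real.exp_nat_mul, Real.exp_log two_pos]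
  rw [Nat.cast_pow, Nat.cast_ofNat, h2, ← Real.exp_nat_mul]
  norm_num

theorem ofReal_decay_pow_mul_le {N : ℕ} (hN : 2 ≤ N) (t : ℕ) (a : ℝ) :
    ENNReal.ofReal (1 - 1 / (4 * (N : ℝ))) ^ t * ENNReal.ofReal (Real.exp a) ≤
      ENNReal.ofReal (Real.exp (a - t / (4 * N))) := by
  have hN' : (2 : ℝ) ≤ N := by exact_mod_cast hN
  have h0 : 0 ≤ 1 - 1 / (4 * (N : ℝ)) := by
    rw [sub_nonneg, div_le_one (by positivity)]; linarith
  rw [← ENNReal.ofReal_pow h0, ← ENNReal.ofReal_mul (by positivity)]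
  refine ENNReal.ofReal_le_ofReal ?_
  calc _ ≤ Real.exp (-(1 / (4 * (N : ℝ)))) ^ t * Real.exp a := by
        gcongr; exact Real.one_sub_le_exp_neg _
    _ = _ := by
        rw [← Real.exp_nat_mul, ← Real.exp_add]; congr 1; ring

theorem half_lt_log_two : (1 : ℝ) / 2 < Real.log 2 := by linarith [Real.log_two_gt_d9]

theorem measure_lt_sortTime_le {γ : ℝ} (hγ : 0 < γ) {N : ℕ} [NeZero N] (hN : 2 ≤ N) {α : Type*}
    [LinearOrder α] (x : Fin (2 ^ N) → α) :
    roundsLaw (matchingLaw N) {ω | ENNReal.ofReal (4 * (4 + γ) / Real.log 2 *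
        Real.log ((2 : ℝ) ^ N) ^ 2) < (sortTime x ω : ℝ≥0∞)} ≤
      ENNReal.ofReal (((2 : ℝ) ^ N) ^ (-γ)) := by
  have hN' : (2 : ℝ) ≤ N := by exact_mod_cast hN
  have hL := half_lt_log_two
  rw [Real.rpow_def_of_pos (by positivity), Real.log_pow]
  set L := Real.log 2
  set X := 4 * (4 + γ) / L * (N * L) ^ 2 with hX
  have hX0 : 0 ≤ X := by positivity
  have hsub : {ω | ENNReal.ofReal X < (sortTime x ω : ℝ≥0∞)} ⊆
      {ω | ¬ Monotone (state ω x ⌊X⌋₊)} := fun ω hω hm => by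
    have h1 : (sortTime x ω : ℝ≥0∞) ≤ (⌊X⌋₊ : ℝ≥0∞) := by
      have := ENat.toENNReal_mono (sortTime_le_iff.2 hm)
      simpa using this
    have h2 : (⌊X⌋₊ : ℝ≥0∞) ≤ ENNReal.ofReal X := by
      rw [← ENNReal.ofReal_natCast]
      exact ENNReal.ofReal_le_ofReal (Nat.floor_le hX0)
    exact absurd (show ENNReal.ofReal X < _ from hω) (not_lt.2 (h1.trans h2))
  refine (measure_mono hsub).trans ((measure_not_monotone_matchingLaw_le hN x _).trans
    ((ofReal_decay_pow_mul_le hN _ _).trans (ENNReal.ofReal_le_ofReal (Real.exp_le_exp.2 ?_))))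
  have h1 : X - 1 < ⌊X⌋₊ := by linarith [Nat.lt_floor_add_one X]
  have h2 : (X - 1) / (4 * N) ≤ ⌊X⌋₊ / (4 * (N : ℝ)) := by gcongr
  -- Of `4 + γ`, the part `3` pays for the initial factor `n ^ 3`, `γ` is the required exponent, and
  -- the remaining `1` absorbs the rounding of `X`.
  have h3 : (X - 1) / (4 * N) = (4 + γ) * (N * L) - 1 / (4 * N) := by
    rw [hX]; field_simp
  have h4 : 1 / (4 * (N : ℝ)) ≤ 1 := by rw [div_le_one (by positivity)]; linarith
  have h5 : 1 ≤ N * L := by nlinarith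
  linarith

theorem lintegral_sortTime_matchingLaw_le {N : ℕ} [NeZero N] (hN : 2 ≤ N) {α : Type*}
    [LinearOrder α] (x : Fin (2 ^ N) → α) :
    ∫⁻ ω, (sortTime x ω : ℝ≥0∞) ∂(roundsLaw (matchingLaw N)) ≤
      ENNReal.ofReal (100 * Real.log ((2 : ℝ) ^ N) ^ 2) := by
  have hN' : (2 : ℝ) ≤ N := by exact_mod_cast hN
  have hL := half_lt_log_two
  have hL1 : Real.log 2 < 1 := by linarith [Real.log_two_lt_d9]
  refine (lintegral_sortTime_le _ x).trans ?_
  have hmono := measure_not_monotone_matchingLaw_le hN x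
  rw [Real.log_pow]
  set L := Real.log 2
  set ρ := 1 - 1 / (4 * (N : ℝ)) with hρ
  -- By round `T` the decay has consumed the factor `n ^ 3`; later rounds form a geometric series
  -- with sum `4 * N`.
  set T := ⌈12 * N * (N * L)⌉₊ with hT
  have hT1 : 12 * N * (N * L) ≤ T := Nat.le_ceil _
  have hT2 : (T : ℝ) < 12 * N * (N * L) + 1 := Nat.ceil_lt_add_one (by positivity)
  have htail : ∀ s : ℕ, roundsLaw (matchingLaw N) {ω | ¬ Monotone (state ω x (s + T))} ≤
      ENNReal.ofReal ρ ^ s := fun s => by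
    refine (hmono _).trans ?_
    rw [pow_add, mul_assoc]
    refine mul_le_of_le_one_right' ((ofReal_decay_pow_mul_le hN _ _).trans ?_)
    rw [ENNReal.ofReal_le_one, Real.exp_le_one_iff, sub_nonpos, le_div_iff₀ (by positivity)]
    linarith
  rw [← ENNReal.summable.sum_add_tsum_nat_add' (k := T)]
  have hhead : ∑ t ∈ Finset.range T, roundsLaw (matchingLaw N) {ω | ¬ Monotone (state ω x t)} ≤
      ENNReal.ofReal T := by
    refine (Finset.sum_le_sum fun t _ => prob_le_one).trans ?_
    simp
  have hgeo : ∑' s : ℕ, roundsLaw (matchingLaw N) {ω | ¬ Monotone (state ω x (s + T))} ≤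
      ENNReal.ofReal (4 * N) := by
    refine (ENNReal.tsum_le_tsum htail).trans ?_
    rw [ENNReal.tsum_geometric]
    have h0 : 0 ≤ ρ := by
      rw [hρ, sub_nonneg, div_le_one (by positivity)]; linarith
    rw [← ENNReal.ofReal_one, ← ENNReal.ofReal_sub _ h0, hρ, sub_sub_cancel,
      ← ENNReal.ofReal_inv_of_pos (by positivity), one_div, inv_inv]
  refine (add_le_add hhead hgeo).trans ?_
  rw [← ENNReal.ofReal_add (by positivity) (by positivity)]
  refine ENNReal.ofReal_le_ofReal ?_
  nlinarith [mul_nonneg (by linarith : (0 : ℝ) ≤ L - 1 / 2) (by linarith : (0 : ℝ) ≤ 1 - L),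
    sq_nonneg ((N : ℝ)), mul_nonneg (by linarith : (0 : ℝ) ≤ L - 1 / 2) (sq_nonneg (N : ℝ)),
    mul_nonneg (mul_nonneg (by linarith : (0 : ℝ) ≤ L - 1 / 2) (by linarith : (0 : ℝ) ≤ L))
      (sq_nonneg (N : ℝ))]

/-- The list with its smallest entry just below the middle is unlikely to be sorted early. -/
theorem measure_monotone_matchingLaw_le {N : ℕ} [NeZero N] (hN : 2 ≤ N) :
    ∃ x : Equiv.Perm (Fin (2 ^ N)), ∀ t : ℕ,
      roundsLaw (matchingLaw N) {ω | Monotone (state ω x t)} ≤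
        ENNReal.ofReal (Real.exp (t / N - N * Real.log 2 / 4)) := by
  have hN' : (2 : ℝ) ≤ N := by exact_mod_cast hN
  have hL := half_lt_log_two
  have h2N : 2 ^ N = 2 * 2 ^ (N - 1) := by
    rw [← pow_succ']; congr 1; omega
  have hpos : 0 < 2 ^ (N - 1) := by positivity
  let p : Fin (2 ^ N) := ⟨2 ^ (N - 1) - 1, by omega⟩
  refine ⟨Equiv.swap 0 p, fun t => ?_⟩
  refine (measure_monotone_le (fun M hM => (matchingLaw_support hN hM).1) (c := 1 / (N : ℝ))
    (by positivity) (fun i j hij hj => (pairProb_toReal_le hN hij hj).trans_eq ?_) p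
    (by simp only [p]; omega) t).trans ?_
  · field_simp
  · rw [← ENNReal.ofReal_pow (by positivity), ← ENNReal.ofReal_mul (by positivity)]
    refine ENNReal.ofReal_le_ofReal ?_
    have h1 : (1 + 1 / (N : ℝ)) ^ t ≤ Real.exp (t / N) := by
      calc (1 + 1 / (N : ℝ)) ^ t ≤ Real.exp (1 / N) ^ t := by
            gcongr; linarith [Real.add_one_le_exp (1 / (N : ℝ))]
        _ = _ := by rw [← Real.exp_nat_mul]; congr 1; ring
    -- `√(2 ^ (N - 1)) ≥ 2 ^ (N / 4)`, because `N - 1 ≥ N / 2` for `N ≥ 2`.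
    have h2 : 1 / √((p : ℝ) + 1) ≤ Real.exp (-(N * Real.log 2 / 4)) := by
      have hp : ((p : ℕ) : ℝ) + 1 = 2 ^ (N - 1) := by
        have : (p : ℕ) + 1 = 2 ^ (N - 1) := by simp only [p]; omega
        exact_mod_cast this
      rw [hp, Real.exp_neg, ← one_div]
      refine one_div_le_one_div_of_le (Real.exp_pos _) (Real.le_sqrt_of_sq_le ?_)
      rw [← Real.exp_log (show (0 : ℝ) < 2 ^ (N - 1) by positivity), Real.log_pow,
        ← Real.exp_nat_mul, Real.exp_le_exp, Nat.cast_sub (by omega)]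
      push_cast
      nlinarith
    calc _ ≤ Real.exp (t / N) * Real.exp (-(N * Real.log 2 / 4)) := by gcongr
      _ = _ := by rw [← Real.exp_add]; congr 1

theorem exists_perm_slow {N : ℕ} [NeZero N] (hN : 2 ≤ N) : ∃ x : Equiv.Perm (Fin (2 ^ N)),
    ENNReal.ofReal (1 / 64 * Real.log ((2 : ℝ) ^ N) ^ 2) ≤
      ∫⁻ ω, (sortTime x ω : ℝ≥0∞) ∂(roundsLaw (matchingLaw N)) ∧
    roundsLaw (matchingLaw N)
        {ω | (sortTime x ω : ℝ≥0∞) < ENNReal.ofReal (1 / 64 * Real.log ((2 : ℝ) ^ N) ^ 2)} ≤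
      ENNReal.ofReal (((2 : ℝ) ^ N) ^ (-(1 / 8) : ℝ)) := by
  have hN' : (2 : ℝ) ≤ N := by exact_mod_cast hN
  have hL := half_lt_log_two
  have hL1 : Real.log 2 < 1 := by linarith [Real.log_two_lt_d9]
  -- The bound `1 + L / 4 ≥ 8 / 7` used below needs `L ≥ 4 / 7`, so `L > 1 / 2` is not enough.
  have hL2 : 0.69 < Real.log 2 := by linarith [Real.log_two_gt_d9]
  obtain ⟨x, hx⟩ := measure_monotone_matchingLaw_le hN
  refine ⟨x, ?_⟩
  rw [Real.rpow_def_of_pos (by positivity), Real.log_pow]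
  set L := Real.log 2
  -- As `L < 1`, `X / N` uses up at most half of the exponent `N * L / 4`. The list is still
  -- unsorted at time `⌊X⌋₊` with probability at least `1 / 8`, whence the constant `1 / 64` for the
  -- expectation.
  set X := 1 / 8 * (N * L) ^ 2 with hX
  have hX0 : 0 ≤ X := by positivity
  have hXT : X < ⌊X⌋₊ + 1 := Nat.lt_floor_add_one X
  have hprob : roundsLaw (matchingLaw N) {ω | Monotone (state ω x ⌊X⌋₊)} ≤
      ENNReal.ofReal (Real.exp (N * L * -(1 / 8))) := by
    refine (hx _).trans (ENNReal.ofReal_le_ofReal (Real.exp_le_exp.2 ?_))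
    have h1 : (⌊X⌋₊ : ℝ) / N ≤ X / N := by gcongr; exact Nat.floor_le hX0
    have h2 : X / N = 1 / 8 * N * L ^ 2 := by rw [hX]; field_simp
    have h3 : (N : ℝ) * L ^ 2 ≤ N * L := by
      have : L ^ 2 ≤ L := by nlinarith
      gcongr
    linarith
  have hle : ∀ ω, ¬ Monotone (state ω x ⌊X⌋₊) → ENNReal.ofReal X ≤ (sortTime x ω : ℝ≥0∞) :=
    fun ω hω => by
      have h1 : ((⌊X⌋₊ + 1 : ℕ) : ℕ∞) ≤ sortTime x ω := by
        by_contra! hc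
        refine hω (sortTime_le_iff.1 ?_)
        push_cast at hc
        exact Order.le_of_lt_add_one hc
      have h2 := ENat.toENNReal_mono h1
      refine le_trans ?_ h2
      rw [ENat.toENNReal_coe, ← ENNReal.ofReal_natCast]
      refine ENNReal.ofReal_le_ofReal ?_
      push_cast
      exact hXT.le
  constructor
  · have hms := measurableSet_state (x : Fin (2 ^ N) → Fin (2 ^ N)) ⌊X⌋₊ Monotone
    have hcompl : ENNReal.ofReal (1 / 8) ≤
        roundsLaw (matchingLaw N) {ω | Monotone (state ω x ⌊X⌋₊)}ᶜ := by
      rw [prob_compl_eq_one_sub hms, ENNReal.le_sub_iff_add_le_right (measure_ne_top _ _)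
        prob_le_one]
      refine (add_le_add_right hprob _).trans ?_
      rw [← ENNReal.ofReal_add (by positivity) (by positivity), ENNReal.ofReal_le_one]
      have h1 : Real.exp (N * L * -(1 / 8)) ≤ Real.exp (-(L / 4)) :=
        Real.exp_le_exp.2 (by nlinarith)
      have h2 : Real.exp (-(L / 4)) ≤ 7 / 8 := by
        rw [Real.exp_neg, inv_le_comm₀ (Real.exp_pos _) (by norm_num)]
        linarith [Real.add_one_le_exp (L / 4)]
      linarith
    calc ENNReal.ofReal (1 / 64 * (N * L) ^ 2) = ENNReal.ofReal X * ENNReal.ofReal (1 / 8) := by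
          rw [← ENNReal.ofReal_mul hX0, hX]; congr 1; ring
      _ ≤ ENNReal.ofReal X *
          roundsLaw (matchingLaw N) {ω | Monotone (state ω x ⌊X⌋₊)}ᶜ := by gcongr
      _ = ∫⁻ ω, {ω | Monotone (state ω x ⌊X⌋₊)}ᶜ.indicator (fun _ => ENNReal.ofReal X) ω
          ∂(roundsLaw (matchingLaw N)) := (lintegral_indicator_const hms.compl _).symm
      _ ≤ _ := lintegral_mono fun ω => by
          classical
          rw [Set.indicator_apply]
          split_ifs with h
          · exact hle ω h
          · exact zero_le
  · refine (measure_mono fun ω hω => ?_).trans hprob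
    by_contra hc
    refine absurd (show (sortTime x ω : ℝ≥0∞) < _ from hω) (not_lt.2 (le_trans ?_ (hle ω hc)))
    refine ENNReal.ofReal_le_ofReal ?_
    rw [hX]
    gcongr
    norm_num

end ParSort

theorem mainTheorem4 :
    -- every possible sample is a matching with exactly `n / 4` pairs
    (∀ (N : ℕ) [NeZero N], 2 ≤ N → ∀ M ∈ (ParSort.matchingLaw N).support,
      ParSort.IsMatching M ∧ (M.card : ℚ) = (2 : ℚ) ^ N / 4) ∧
    -- the expected number of rounds is at most of order `(log n)^2`, for every list
    (∃ C : ℝ, 0 < C ∧ ∀ (N : ℕ) [NeZero N], 2 ≤ N →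
      ∀ (α : Type*) [LinearOrder α] (x : Fin (2 ^ N) → α),
        ∫⁻ ω, (ParSort.sortTime x ω : ℝ≥0∞) ∂(ParSort.roundsLaw (ParSort.matchingLaw N)) ≤
          ENNReal.ofReal (C * Real.log ((2 : ℝ) ^ N) ^ 2)) ∧
    -- order `(log n)^2` rounds suffice up to polynomially small failure probability, for every list
    (∀ γ : ℝ, 0 < γ → ∃ C : ℝ, 0 < C ∧ ∀ (N : ℕ) [NeZero N], 2 ≤ N →
      ∀ (α : Type*) [LinearOrder α] (x : Fin (2 ^ N) → α),
        ParSort.roundsLaw (ParSort.matchingLaw N)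
            {ω | ENNReal.ofReal (C * Real.log ((2 : ℝ) ^ N) ^ 2) < (ParSort.sortTime x ω : ℝ≥0∞)} ≤
          ENNReal.ofReal (((2 : ℝ) ^ N) ^ (-γ))) ∧
    -- order `(log n)^2` rounds are needed in the worst case, in both senses
    (∃ c : ℝ, 0 < c ∧ ∃ γ : ℝ, 0 < γ ∧ ∀ (N : ℕ) [NeZero N], 2 ≤ N →
      ∃ x : Equiv.Perm (Fin (2 ^ N)),
        ENNReal.ofReal (c * Real.log ((2 : ℝ) ^ N) ^ 2) ≤
          ∫⁻ ω, (ParSort.sortTime x ω : ℝ≥0∞) ∂(ParSort.roundsLaw (ParSort.matchingLaw N)) ∧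
        ParSort.roundsLaw (ParSort.matchingLaw N)
            {ω | (ParSort.sortTime x ω : ℝ≥0∞) < ENNReal.ofReal (c * Real.log ((2 : ℝ) ^ N) ^ 2)} ≤
          ENNReal.ofReal (((2 : ℝ) ^ N) ^ (-γ))) := by
  refine ⟨fun N _ hN M hM => ParSort.matchingLaw_support hN hM,
    ⟨100, by norm_num, fun N _ hN α _ x => ParSort.lintegral_sortTime_matchingLaw_le hN x⟩,
    fun γ hγ => ⟨4 * (4 + γ) / Real.log 2, by positivity, fun N _ hN α _ x =>
      ParSort.measure_lt_sortTime_le hγ hN x⟩,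
    1 / 64, by norm_num, 1 / 8, by norm_num, fun N _ hN => ParSort.exists_perm_slow hN⟩
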